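/- For $\kappa\ge 0$ let $\mathbb{C}_\kappa=\{s\in\mathbb{C}:\operatorname{Re}s>\kappa\}$, and let $H^\infty(\mathbb{C}_0)$ be the Banach space of bounded analytic functions on $\mathbb{C}_0$ with the supremum norm. A function $f$ on $\mathbb{C}_\kappa$ is called almost periodic on $\mathbb{C}_\kappa$ if it is bounded and uniformly continuous there and, for every $\varepsilon>0$, the set of all $\tau\in\mathbb{R}$ with $|f(s+i\tau)-f(s)|\le\varepsilon$ for all $s\in\mathbb{C}_\kappa$ is relatively dense, i.e. meets every closed interval of length $d$ for some $d=d(\varepsilon)>0$. Let $H^\infty_{\mathrm{ap}}(\mathbb{C}_0)\subseteq H^\infty(\mathbb{C}_0)$ be the subspace of those $f$ that are almost periodic on $\mathbb{C}_\kappa$ for some $\kappa>0$. Let $\lambda=\{\lambda_n\}_{n\ge1}$ be a frequency, that is, a nondecreasing sequence of non-negative real numbers with limit $\infty$, and let $L(\lambda)\in[0,\infty]$ be the abscissa of convergence of $\sum_{n\ge1}e^{-\lambda_ns}$. Let $\mathscr{D}^\infty_{\mathrm{ext}}(\lambda)$ be the space of all $f\in H^\infty(\mathbb{C}_0)$ for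 which there are $\kappa>0$ and complex numbers $a_n$ such that $f(s)=\sum_{n=1}^\infty a_ne^{-\lambda_ns}$, as a convergent series, for all $s\in\mathbb{C}_\kappa$. Let $H^\infty_\lambda(\mathbb{C}_0)$ be the space of all $f\in H^\infty_{\mathrm{ap}}(\mathbb{C}_0)$ such that every $\mu\ge0$ with nonzero Bohr coefficient $$a_\mu(f)=\lim_{T\to\infty}\frac1{2T}\int_{-T}^{T}f(\sigma+it)\,e^{\mu(\sigma+it)}\,\mathrm{d}t\qquad(\sigma>0)$$ is one of the numbers $\lambda_n$ (the limit exists and does not depend on $\sigma>0$). These spaces carry the supremum norm. Let $W$ be either $\mathscr{D}^\infty_{\mathrm{ext}}(\lambda)$ with $L(\lambda)<\infty$, or $H^\infty_\lambda(\mathbb{C}_0)$ (with $\lambda$ an arbitrary frequency). Let $\varphi:\mathbb{C}_0\to\mathbb{C}_0$ be a map that induces a bounded composition operator $C_\varphi:W\to H^\infty_{\mathrm{ap}}(\mathbb{C}_0)$, $C_\varphi f=f\circ\varphi$. Then $C_\varphi$ is compact if and only if $\varphi(\mathbb{C}_0)\subseteq\mathbb{C}_\kappa$ for some $\kappa>0$.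 -/

import Mathlib

open Filter Topology
open scoped BoundedContinuousFunction

namespace HalfPlane

/-- The open half-plane `{s : Re s > κ}`. -/
def halfPlane (κ : ℝ) : Set ℂ := {s : ℂ | κ < s.re}

/-- The open right half-plane, as a type. -/
abbrev RightHalfPlane : Type := halfPlane 0

/-- The bounded continuous functions on the open right half-plane, with the supremum norm.  All the
function spaces below are subspaces of this Banach space and carry its norm. -/
abbrev BoundedFun : Type := RightHalfPlane →ᵇ ℂ

/-- Extension by zero of a function on the right half-plane to the whole plane; only the values on
the right half-plane are ever used. -/
noncomputable def ext (f : BoundedFun) : ℂ → ℂ :=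
  Function.extend (Subtype.val : RightHalfPlane → ℂ) f 0

theorem ext_apply (f : BoundedFun) (s : RightHalfPlane) : ext f s = f s :=
  Subtype.val_injective.extend_apply _ _ _

theorem ext_of_mem (f : BoundedFun) {s : ℂ} (hs : s ∈ halfPlane 0) : ext f s = f ⟨s, hs⟩ :=
  ext_apply f ⟨s, hs⟩

theorem ext_of_notMem (f : BoundedFun) {s : ℂ} (hs : s ∉ halfPlane 0) : ext f s = 0 := by
  unfold ext
  rw [Function.extend_apply']
  · rfl
  · rintro ⟨a, rfl⟩
    exact hs a.2

theorem ext_zero : ext 0 = 0 := by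
  funext s
  by_cases hs : s ∈ halfPlane 0
  · rw [ext_of_mem _ hs]; rfl
  · rw [ext_of_notMem _ hs]; rfl

theorem ext_add (f g : BoundedFun) : ext (f + g) = ext f + ext g := by
  funext s
  by_cases hs : s ∈ halfPlane 0
  · simp [ext_of_mem _ hs]
  · simp [ext_of_notMem _ hs]

theorem ext_smul (c : ℂ) (f : BoundedFun) : ext (c • f) = fun s => c * ext f s := by
  funext s
  by_cases hs : s ∈ halfPlane 0
  · simp [ext_of_mem _ hs]
  · simp [ext_of_notMem _ hs]

/-- The Banach space `H^∞(ℂ₀)` of bounded analytic functions on the right half-plane, with the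
supremum norm. -/
noncomputable def Hinf : Submodule ℂ BoundedFun where
  carrier := {f | DifferentiableOn ℂ (ext f) (halfPlane 0)}
  zero_mem' := by
    simp only [Set.mem_ofPred_eq, ext_zero]
    exact differentiableOn_const 0
  add_mem' := by
    intro f g hf hg
    simp only [Set.mem_ofPred_eq, ext_add] at *
    exact hf.add hg
  smul_mem' := by
    intro c f hf
    simp only [Set.mem_ofPred_eq, ext_smul] at *
    exact hf.const_mul c

/-- A set of reals is relatively dense if some `d > 0` exists such that it meets every closed
interval of length `d`. -/
def RelativelyDense (A : Set ℝ) : Prop :=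
  ∃ d : ℝ, 0 < d ∧ ∀ a : ℝ, ∃ x ∈ A, x ∈ Set.Icc a (a + d)

/-- The set `E_f(ε)` of `ε`-translation numbers of `f` on the half-plane `Re s > κ`. -/
def translationNumbers (κ : ℝ) (f : ℂ → ℂ) (ε : ℝ) : Set ℝ :=
  {τ : ℝ | ∀ s ∈ halfPlane κ, ‖f (s + Complex.I * τ) - f s‖ ≤ ε}

/-- Almost periodicity of `f` on the half-plane `Re s > κ`. -/
structure AlmostPeriodicOn (κ : ℝ) (f : ℂ → ℂ) : Prop where
  bounded : ∃ M : ℝ, ∀ s ∈ halfPlane κ, ‖f s‖ ≤ M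
  uniformContinuousOn : UniformContinuousOn f (halfPlane κ)
  relativelyDense : ∀ ε : ℝ, 0 < ε → RelativelyDense (translationNumbers κ f ε)

theorem add_I_mem {κ : ℝ} {s : ℂ} (hs : s ∈ halfPlane κ) (τ : ℝ) :
    s + Complex.I * τ ∈ halfPlane κ := by
  simpa [halfPlane] using hs

theorem RelativelyDense.mono {A B : Set ℝ} (h : RelativelyDense A) (hAB : A ⊆ B) :
    RelativelyDense B := by
  obtain ⟨d, hd, H⟩ := h
  refine ⟨d, hd, fun a => ?_⟩
  obtain ⟨x, hx, hx'⟩ := H a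
  exact ⟨x, hAB hx, hx'⟩

theorem AlmostPeriodicOn.mono {κ κ' : ℝ} {f : ℂ → ℂ} (h : AlmostPeriodicOn κ f) (hκ : κ ≤ κ') :
    AlmostPeriodicOn κ' f := by
  have hsub : halfPlane κ' ⊆ halfPlane κ := fun s hs => lt_of_le_of_lt hκ hs
  refine ⟨?_, h.uniformContinuousOn.mono hsub, fun ε hε => ?_⟩
  · obtain ⟨M, hM⟩ := h.bounded
    exact ⟨M, fun s hs => hM s (hsub hs)⟩
  · exact (h.relativelyDense ε hε).mono fun τ hτ s hs => hτ s (hsub hs)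

/-- The vertical translates of an almost periodic function form a totally bounded family. -/
theorem AlmostPeriodicOn.exists_finite_net {κ : ℝ} {f : ℂ → ℂ} (h : AlmostPeriodicOn κ f)
    {ε : ℝ} (hε : 0 < ε) :
    ∃ F : Set ℝ, F.Finite ∧ ∀ τ : ℝ, ∃ p ∈ F, ∀ s ∈ halfPlane κ,
      ‖f (s + Complex.I * τ) - f (s + Complex.I * p)‖ ≤ ε := by
  obtain ⟨d, hd, hD⟩ := h.relativelyDense (ε / 2) (half_pos hε)
  obtain ⟨δ, hδ, hU⟩ := Metric.uniformContinuousOn_iff.1 h.uniformContinuousOn (ε / 2) (half_pos hε)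
  obtain ⟨F, -, hF, hcov⟩ := (isCompact_Icc (a := (0 : ℝ)) (b := d)).finite_cover_balls hδ
  refine ⟨F, hF, fun τ => ?_⟩
  obtain ⟨x, hx, hx1, hx2⟩ := hD (τ - d)
  have hmem : τ - x ∈ Set.Icc (0 : ℝ) d := ⟨by linarith, by linarith⟩
  obtain ⟨p, hp, hball⟩ := Set.mem_iUnion₂.1 (hcov hmem)
  refine ⟨p, hp, fun s hs => ?_⟩
  have h1 := hx (s + Complex.I * ((τ - x : ℝ) : ℂ)) (add_I_mem hs _)
  have h2 := hU (s + Complex.I * ((τ - x : ℝ) : ℂ)) (add_I_mem hs _) (s + Complex.I * p)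
    (add_I_mem hs _) (by
      rw [Metric.mem_ball, Real.dist_eq] at hball
      rw [dist_eq_norm]
      have : s + Complex.I * ((τ - x : ℝ) : ℂ) - (s + Complex.I * p)
          = Complex.I * ((τ - x - p : ℝ) : ℂ) := by push_cast; ring
      rw [this, norm_mul, Complex.norm_I, one_mul, Complex.norm_real]
      exact hball)
  rw [dist_eq_norm] at h2
  have h3 : s + Complex.I * ((τ - x : ℝ) : ℂ) + Complex.I * x = s + Complex.I * τ := by
    push_cast; ring
  rw [h3] at h1
  have h4 := norm_sub_le_norm_sub_add_norm_sub (f (s + Complex.I * τ))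
    (f (s + Complex.I * ((τ - x : ℝ) : ℂ))) (f (s + Complex.I * p))
  linarith

/-- Two almost periodic functions are jointly almost periodic. -/
theorem AlmostPeriodicOn.joint {κ : ℝ} {f g : ℂ → ℂ} (hf : AlmostPeriodicOn κ f)
    (hg : AlmostPeriodicOn κ g) {ε : ℝ} (hε : 0 < ε) :
    RelativelyDense (translationNumbers κ f ε ∩ translationNumbers κ g ε) := by
  obtain ⟨F, hF, hFn⟩ := hf.exists_finite_net (half_pos hε)
  obtain ⟨G, hG, hGn⟩ := hg.exists_finite_net (half_pos hε)
  choose P hP hP' using hFn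
  choose Q hQ hQ' using hGn
  let h : ℝ → ℝ × ℝ := fun τ => (P τ, Q τ)
  have hfin : (Set.range h).Finite := (hF.prod hG).subset (by
    rintro _ ⟨τ, rfl⟩
    exact ⟨hP τ, hQ τ⟩)
  let rep : ℝ × ℝ → ℝ := Function.invFun h
  have hrep : ∀ τ, h (rep (h τ)) = h τ := fun τ => Function.invFun_eq ⟨τ, rfl⟩
  obtain ⟨R, hR⟩ := (hfin.image rep).isBounded.exists_norm_le
  have hR' : ∀ τ, |rep (h τ)| ≤ R := fun τ => hR _ ⟨h τ, ⟨τ, rfl⟩, rfl⟩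
  have hR0 : 0 ≤ R := (abs_nonneg _).trans (hR' 0)
  refine ⟨2 * R + 1, by linarith, fun a => ?_⟩
  set τ := a + R with hτ
  set r := rep (h τ) with hr
  have hPr : P r = P τ := congrArg Prod.fst (hrep τ)
  have hQr : Q r = Q τ := congrArg Prod.snd (hrep τ)
  have hrR := abs_le.1 (hR' τ)
  have key : ∀ (u : ℂ → ℂ) (p : ℝ),
      (∀ s ∈ halfPlane κ, ‖u (s + Complex.I * τ) - u (s + Complex.I * p)‖ ≤ ε / 2) →
      (∀ s ∈ halfPlane κ, ‖u (s + Complex.I * r) - u (s + Complex.I * p)‖ ≤ ε / 2) →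
      τ - r ∈ translationNumbers κ u ε := by
    intro u p h1 h2 s hs
    have e1 := h1 _ (add_I_mem hs (-r))
    have e2 := h2 _ (add_I_mem hs (-r))
    have i1 : s + Complex.I * ((-r : ℝ) : ℂ) + Complex.I * τ
        = s + Complex.I * ((τ - r : ℝ) : ℂ) := by push_cast; ring
    have i2 : s + Complex.I * ((-r : ℝ) : ℂ) + Complex.I * r = s := by push_cast; ring
    rw [i1] at e1
    rw [i2, norm_sub_rev] at e2
    have h4 := norm_sub_le_norm_sub_add_norm_sub (u (s + Complex.I * ((τ - r : ℝ) : ℂ)))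
      (u (s + Complex.I * ((-r : ℝ) : ℂ) + Complex.I * p)) (u s)
    linarith
  refine ⟨τ - r, ⟨key f (P τ) (hP' τ) ?_, key g (Q τ) (hQ' τ) ?_⟩, ?_, ?_⟩
  · rw [← hPr]; exact hP' r
  · rw [← hQr]; exact hQ' r
  · linarith [hrR.2]
  · linarith [hrR.1]

theorem AlmostPeriodicOn.zero (κ : ℝ) : AlmostPeriodicOn κ 0 := by
  refine ⟨⟨0, by simp⟩, uniformContinuous_const.uniformContinuousOn, fun ε hε => ?_⟩
  exact ⟨1, one_pos, fun a => ⟨a, fun s _ => by simpa using hε.le, by simp⟩⟩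

theorem AlmostPeriodicOn.add {κ : ℝ} {f g : ℂ → ℂ} (hf : AlmostPeriodicOn κ f)
    (hg : AlmostPeriodicOn κ g) : AlmostPeriodicOn κ (f + g) := by
  have huc : UniformContinuousOn (f + g) (halfPlane κ) :=
    (uniformContinuousOn_iff_restrict.2 <|
      (uniformContinuousOn_iff_restrict.1 hf.uniformContinuousOn).add
        (uniformContinuousOn_iff_restrict.1 hg.uniformContinuousOn))
  refine ⟨?_, huc, fun ε hε => ?_⟩
  · obtain ⟨M, hM⟩ := hf.bounded
    obtain ⟨N, hN⟩ := hg.bounded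
    exact ⟨M + N, fun s hs => (norm_add_le _ _).trans (add_le_add (hM s hs) (hN s hs))⟩
  · refine (hf.joint hg (half_pos hε)).mono ?_
    rintro τ ⟨h1, h2⟩ s hs
    have e : (f + g) (s + Complex.I * τ) - (f + g) s
        = (f (s + Complex.I * τ) - f s) + (g (s + Complex.I * τ) - g s) := by
      simp only [Pi.add_apply]; ring
    rw [e]
    have := norm_add_le (f (s + Complex.I * τ) - f s) (g (s + Complex.I * τ) - g s)
    linarith [h1 s hs, h2 s hs]

theorem AlmostPeriodicOn.const_mul {κ : ℝ} {f : ℂ → ℂ} (hf : AlmostPeriodicOn κ f) (c : ℂ) :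
    AlmostPeriodicOn κ (fun s => c * f s) := by
  refine ⟨?_, ?_, fun ε hε => ?_⟩
  · obtain ⟨M, hM⟩ := hf.bounded
    exact ⟨‖c‖ * M, fun s hs => by
      rw [norm_mul]; exact mul_le_mul_of_nonneg_left (hM s hs) (norm_nonneg c)⟩
  · exact (uniformContinuous_const_smul c).comp_uniformContinuousOn hf.uniformContinuousOn
  · have hc : 0 < ‖c‖ + 1 := by positivity
    refine (hf.relativelyDense (ε / (‖c‖ + 1)) (by positivity)).mono fun τ hτ s hs => ?_
    rw [← mul_sub, norm_mul]
    calc ‖c‖ * ‖f (s + Complex.I * τ) - f s‖ ≤ (‖c‖ + 1) * (ε / (‖c‖ + 1)) :=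
          mul_le_mul (by linarith) (hτ s hs) (norm_nonneg _) hc.le
      _ = ε := by field_simp

/-- The space `H^∞_ap(ℂ₀)` of bounded analytic functions on the right half-plane that are almost
periodic on some half-plane `Re s > κ` with `κ > 0`. -/
noncomputable def Hap : Submodule ℂ BoundedFun where
  carrier := {f | f ∈ Hinf ∧ ∃ κ : ℝ, 0 < κ ∧ AlmostPeriodicOn κ (ext f)}
  zero_mem' := ⟨Hinf.zero_mem, 1, one_pos, by rw [ext_zero]; exact AlmostPeriodicOn.zero 1⟩
  add_mem' := by
    rintro f g ⟨hf, κ, hκ, hfκ⟩ ⟨hg, κ', hκ', hgκ'⟩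
    refine ⟨Hinf.add_mem hf hg, max κ κ', lt_max_of_lt_left hκ, ?_⟩
    rw [ext_add]
    exact (hfκ.mono (le_max_left _ _)).add (hgκ'.mono (le_max_right _ _))
  smul_mem' := by
    rintro c f ⟨hf, κ, hκ, hfκ⟩
    refine ⟨Hinf.smul_mem c hf, κ, hκ, ?_⟩
    rw [ext_smul]
    exact hfκ.const_mul c

/-- A frequency: an increasing (possibly with repetitions) sequence of non-negative reals tending
to infinity. The index set is `ℕ`, so `lam n` is the `(n+1)`-st term. -/
structure IsFrequency (lam : ℕ → ℝ) : Prop where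
  monotone : Monotone lam
  nonneg : ∀ n, 0 ≤ lam n
  tendsto : Tendsto lam atTop atTop

/-- The general Dirichlet series `∑ a_n e^{-λ_n s}` converges (in the sense of partial sums) to `z`
at the point `s`. -/
def DirichletConvergesTo (lam : ℕ → ℝ) (a : ℕ → ℂ) (s z : ℂ) : Prop :=
  Tendsto (fun N : ℕ => ∑ n ∈ Finset.range N, a n * Complex.exp (-(lam n : ℂ) * s)) atTop (𝓝 z)

/-- The abscissa of convergence `L(λ)` of the series `∑ e^{-λ_n s}`, an extended real number
(`⊤` if the series converges nowhere). -/
noncomputable def abscissaL (lam : ℕ → ℝ) : EReal :=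
  sInf (Real.toEReal '' {σ : ℝ | ∃ z : ℂ, DirichletConvergesTo lam (fun _ => 1) (σ : ℂ) z})

/-- The space `D^∞_ext(λ)` of all bounded analytic functions on the right half-plane that are the
sum of a convergent `λ`-Dirichlet series on some half-plane `Re s > κ` with `κ > 0`. -/
noncomputable def Dext (lam : ℕ → ℝ) : Submodule ℂ BoundedFun where
  carrier := {f | f ∈ Hinf ∧ ∃ (a : ℕ → ℂ) (κ : ℝ), 0 < κ ∧
    ∀ s ∈ halfPlane κ, DirichletConvergesTo lam a s (ext f s)}
  zero_mem' := ⟨Hinf.zero_mem, 0, 1, one_pos, fun s _ => by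
    simp [DirichletConvergesTo, ext_zero]⟩
  add_mem' := by
    rintro f g ⟨hf, a, κ, hκ, hfa⟩ ⟨hg, b, κ', hκ', hgb⟩
    refine ⟨Hinf.add_mem hf hg, a + b, max κ κ', lt_max_of_lt_left hκ, fun s hs => ?_⟩
    have h1 := hfa s (lt_of_le_of_lt (le_max_left κ κ') (show max κ κ' < s.re from hs))
    have h2 := hgb s (lt_of_le_of_lt (le_max_right κ κ') (show max κ κ' < s.re from hs))
    rw [ext_add]
    unfold DirichletConvergesTo at *
    simpa [add_mul, Finset.sum_add_distrib] using h1.add h2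
  smul_mem' := by
    rintro c f ⟨hf, a, κ, hκ, hfa⟩
    refine ⟨Hinf.smul_mem c hf, c • a, κ, hκ, fun s hs => ?_⟩
    have h1 := hfa s hs
    rw [ext_smul]
    unfold DirichletConvergesTo at *
    simpa [mul_assoc, Finset.mul_sum] using h1.const_mul c

/-- The mean `(1/2T) ∫_{-T}^{T} f(σ + it) e^{μ(σ + it)} dt`. -/
noncomputable def bohrMean (f : BoundedFun) (μ σ T : ℝ) : ℂ :=
  (1 / (2 * T) : ℂ) * ∫ t in (-T)..T,
    ext f (σ + Complex.I * t) * Complex.exp (μ * (σ + Complex.I * t))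

/-- `a` is the Bohr coefficient `a_μ(f)`, i.e. the limit of the means as `T → ∞`, on every vertical
line `Re s = σ` with `σ > 0`. For `f ∈ H^∞_ap(ℂ₀)` and `μ ≥ 0` the limit exists and does not depend
on `σ`. -/
def HasBohrCoeff (f : BoundedFun) (μ : ℝ) (a : ℂ) : Prop :=
  ∀ σ : ℝ, 0 < σ → Tendsto (bohrMean f μ σ) atTop (𝓝 a)

/-- The Bohr spectrum `Λ(f)`: the `μ ≥ 0` whose Bohr coefficient is not zero. -/
def bohrSpectrum (f : BoundedFun) : Set ℝ := {μ : ℝ | 0 ≤ μ ∧ ¬ HasBohrCoeff f μ 0}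

theorem continuous_bohrIntegrand (f : BoundedFun) (μ : ℝ) {σ : ℝ} (hσ : 0 < σ) :
    Continuous fun t : ℝ =>
      ext f (σ + Complex.I * t) * Complex.exp (μ * (σ + Complex.I * t)) := by
  have hmem : ∀ t : ℝ, (σ + Complex.I * t : ℂ) ∈ halfPlane 0 := fun t => by
    simpa [halfPlane] using hσ
  have h1 : (fun t : ℝ => ext f (σ + Complex.I * t)) = fun t : ℝ => f ⟨_, hmem t⟩ :=
    funext fun t => ext_of_mem f (hmem t)
  have h2 : Continuous fun t : ℝ => ext f (σ + Complex.I * t) := by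
    rw [h1]
    exact f.continuous.comp (Continuous.subtype_mk (by fun_prop) _)
  exact h2.mul (by fun_prop)

theorem HasBohrCoeff.zero (μ : ℝ) : HasBohrCoeff 0 μ 0 := fun σ _ => by
  have : bohrMean 0 μ σ = fun _ => 0 := by
    funext T
    simp [bohrMean, ext_zero]
  rw [this]
  exact tendsto_const_nhds

theorem HasBohrCoeff.add {f g : BoundedFun} {μ : ℝ} {a b : ℂ} (hf : HasBohrCoeff f μ a)
    (hg : HasBohrCoeff g μ b) : HasBohrCoeff (f + g) μ (a + b) := fun σ hσ => by
  have : bohrMean (f + g) μ σ = fun T => bohrMean f μ σ T + bohrMean g μ σ T := by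
    funext T
    unfold bohrMean
    rw [← mul_add, ← intervalIntegral.integral_add
      ((continuous_bohrIntegrand f μ hσ).intervalIntegrable _ _)
      ((continuous_bohrIntegrand g μ hσ).intervalIntegrable _ _), ext_add]
    simp only [Pi.add_apply, add_mul]
  rw [this]
  exact (hf σ hσ).add (hg σ hσ)

theorem HasBohrCoeff.smul {f : BoundedFun} {μ : ℝ} {a : ℂ} (hf : HasBohrCoeff f μ a) (c : ℂ) :
    HasBohrCoeff (c • f) μ (c * a) := fun σ hσ => by
  have : bohrMean (c • f) μ σ = fun T => c * bohrMean f μ σ T := by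
    funext T
    unfold bohrMean
    rw [ext_smul, mul_left_comm]
    simp only [mul_assoc]
    rw [intervalIntegral.integral_const_mul]
  rw [this]
  exact (hf σ hσ).const_mul c

/-- The space `H^∞_λ(ℂ₀)` of all `f ∈ H^∞_ap(ℂ₀)` whose Bohr spectrum is contained in
`{λ_n : n}`. -/
noncomputable def Hlam (lam : ℕ → ℝ) : Submodule ℂ BoundedFun where
  carrier := {f | f ∈ Hap ∧ bohrSpectrum f ⊆ Set.range lam}
  zero_mem' := ⟨Hap.zero_mem, fun μ hμ => absurd (HasBohrCoeff.zero μ) hμ.2⟩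
  add_mem' := by
    rintro f g ⟨hf, hf'⟩ ⟨hg, hg'⟩
    refine ⟨Hap.add_mem hf hg, fun μ hμ => ?_⟩
    by_contra hn
    have h1 : HasBohrCoeff f μ 0 := by
      by_contra h
      exact hn (hf' ⟨hμ.1, h⟩)
    have h2 : HasBohrCoeff g μ 0 := by
      by_contra h
      exact hn (hg' ⟨hμ.1, h⟩)
    exact hμ.2 (by simpa using h1.add h2)
  smul_mem' := by
    rintro c f ⟨hf, hf'⟩
    refine ⟨Hap.smul_mem c hf, fun μ hμ => ?_⟩
    by_contra hn
    have h1 : HasBohrCoeff f μ 0 := by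
      by_contra h
      exact hn (hf' ⟨hμ.1, h⟩)
    exact hμ.2 (by simpa using h1.smul c)

/-- `C : W → H^∞_ap(ℂ₀)` is the composition operator `f ↦ f ∘ φ`. -/
def IsCompositionOperator (W : Submodule ℂ BoundedFun) (φ : RightHalfPlane → RightHalfPlane)
    (C : W →L[ℂ] Hap) : Prop :=
  ∀ (f : W) (s : RightHalfPlane), (C f : BoundedFun) s = (f : BoundedFun) (φ s)

end HalfPlane

/-! Only two properties of `W` matter: it contains every exponential `e^{-λ_n s}`, and it lies in
`Hlam lam`. For `Dext lam` the second holds because a finite `L(λ)` makes the series converge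
uniformly far to the right (`Dext_le_Hlam`).

Compactness forces the range condition. The functions `e^{-λ_n φ}` are images of elements of the
unit ball, so a subsequence converges in norm. Its pointwise limit is `0`, since `Re φ > 0` and `λ_n
→ ∞`. If `Re φ` came arbitrarily close to `0`, each of these functions would have norm at least `1`.

The converse rests on `exists_approx`: on `Re s > κ` the unit ball of `Hlam lam` is approximated
within `ε` by Dirichlet polynomials whose frequency set is finite and fixed, with coefficient bounds
independent of the function. The image of the unit ball under `C` is then totally bounded, and `Hap`
is complete because almost periodicity spreads to every `Re s > δ > 0` by the three lines theorem
(`Hap.almostPeriodicOn`).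

To approximate, restrict `f` to `Re s = κ`, where Cauchy's estimate makes it Lipschitz, and convolve
with a band-limited kernel of small first moment. The convolution keeps only the finitely many
frequencies in the band; negative ones are absent, as moving the line of integration to the right
shows. It is therefore a trigonometric polynomial by the uniqueness theorem `IsBohrAP.eq_zero`, and
Phragmén–Lindelöf carries the estimate from the line to the half-plane.

The uniqueness theorem compares two estimates for the autocorrelation of `h` cut off to `(0, T]`.
Vanishing means are small uniformly in the frequency, so the Fourier transform of the cut-off is
`o(T)` in supremum norm, and Parseval makes the energy of the autocorrelation `o(T^3)`. At
translation numbers of a nonzero `h` the autocorrelation is of order `T`, and these numbers have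
positive lower density, so the energy is at least a constant times `T^3`. -/

namespace HalfPlane

open MeasureTheory

/-! ### Almost periodic functions on the line -/

/-- Bohr almost periodicity of a function of a real variable. -/
def IsBohrAP (h : ℝ → ℂ) : Prop := AlmostPeriodicOn 0 fun s : ℂ => h s.im

/-- `IsBohrAP` is phrased through `s ↦ h s.im` on a half-plane; evaluating at `1 + it` turns its
conditions back into statements about `h t`. -/
theorem one_add_mem (t : ℝ) : (1 + Complex.I * t : ℂ) ∈ halfPlane 0 := by
  simp [halfPlane]

theorem IsBohrAP.exists_bound {h : ℝ → ℂ} (hh : IsBohrAP h) : ∃ M : ℝ, 0 < M ∧ ∀ t, ‖h t‖ ≤ M := by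
  obtain ⟨M, hM⟩ := hh.bounded
  refine ⟨max M 1, lt_max_of_lt_right one_pos, fun t => le_max_of_le_left ?_⟩
  simpa using hM _ (one_add_mem t)

theorem IsBohrAP.exists_delta {h : ℝ → ℂ} (hh : IsBohrAP h) {ε : ℝ} (hε : 0 < ε) :
    ∃ δ > 0, ∀ s t : ℝ, |s - t| < δ → ‖h s - h t‖ < ε := by
  obtain ⟨δ, hδ, H⟩ := Metric.uniformContinuousOn_iff.1 hh.uniformContinuousOn ε hε
  refine ⟨δ, hδ, fun s t hst => ?_⟩
  have := H _ (one_add_mem s) _ (one_add_mem t) (by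
    rw [dist_eq_norm, add_sub_add_left_eq_sub, ← mul_sub, norm_mul, Complex.norm_I, one_mul,
      ← Complex.ofReal_sub, Complex.norm_real]
    exact hst)
  simpa [dist_eq_norm] using this

theorem IsBohrAP.continuous {h : ℝ → ℂ} (hh : IsBohrAP h) : Continuous h := by
  refine Metric.continuous_iff.2 fun t ε hε => ?_
  obtain ⟨δ, hδ, H⟩ := hh.exists_delta hε
  exact ⟨δ, hδ, fun s hs => by simpa [dist_eq_norm] using H s t (by simpa [Real.dist_eq] using hs)⟩

theorem IsBohrAP.exists_translation {h : ℝ → ℂ} (hh : IsBohrAP h) {ε : ℝ} (hε : 0 < ε) :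
    ∃ d : ℝ, 0 < d ∧ ∀ a : ℝ, ∃ τ ∈ Set.Icc a (a + d), ∀ t, ‖h (t + τ) - h t‖ ≤ ε := by
  obtain ⟨d, hd, H⟩ := hh.relativelyDense ε hε
  refine ⟨d, hd, fun a => ?_⟩
  obtain ⟨τ, hτ, hm⟩ := H a
  exact ⟨τ, hm, fun t => by simpa using hτ _ (one_add_mem t)⟩

/-- The character `t ↦ e^{iμt}`. -/
noncomputable def character (μ t : ℝ) : ℂ := Complex.exp ((μ * t : ℝ) * Complex.I)

theorem norm_character (μ t : ℝ) : ‖character μ t‖ = 1 := Complex.norm_exp_ofReal_mul_I _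

theorem character_add (μ s t : ℝ) : character μ (s + t) = character μ s * character μ t := by
  rw [character, character, character, ← Complex.exp_add]
  congr 1; push_cast; ring

theorem character_add_left (μ ν t : ℝ) : character (μ + ν) t = character μ t * character ν t := by
  rw [character, character, character, ← Complex.exp_add]
  congr 1; push_cast; ring

@[fun_prop]
theorem continuous_character (μ : ℝ) : Continuous (character μ) := by
  unfold character; fun_prop

theorem norm_character_sub_one_le (μ t : ℝ) : ‖character μ t - 1‖ ≤ |μ * t| := by
  rw [character, mul_comm]
  exact Real.norm_exp_I_mul_ofReal_sub_one_le

/-! ### Integrals over long intervals, cut into blocks -/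

/-- At least `R / D - 1` full blocks fit into `[0, R]`; the remainder contributes a non-negative
amount. -/
theorem le_integral_of_blocks {q : ℝ → ℝ} (hq : ∀ a b, IntervalIntegrable q volume a b)
    (h0 : ∀ t, 0 ≤ q t) {D v : ℝ} (hD : 0 < D) (hv : 0 ≤ v)
    (hb : ∀ a, v ≤ ∫ t in a..a + D, q t) {R : ℝ} (hR : 0 ≤ R) :
    (R / D - 1) * v ≤ ∫ t in (0 : ℝ)..R, q t := by
  set n := ⌊R / D⌋₊ with hn
  have hsum : (n : ℝ) * v ≤ ∫ t in (0 : ℝ)..(n * D), q t := by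
    have := intervalIntegral.sum_integral_adjacent_intervals (f := q) (μ := volume)
      (a := fun k : ℕ => (k : ℝ) * D) (n := n) (fun k _ => hq _ _)
    simp only [Nat.cast_zero, zero_mul] at this
    rw [← this]
    calc (n : ℝ) * v = ∑ k ∈ Finset.range n, v := by simp
      _ ≤ _ := Finset.sum_le_sum fun k _ => by
        have := hb (k * D)
        rwa [show ((k + 1 : ℕ) : ℝ) * D = k * D + D by push_cast; ring]
  have hle : (n : ℝ) * D ≤ R := by
    rw [← le_div_iff₀ hD]; exact Nat.floor_le (by positivity)
  have h1 : ∫ t in (0 : ℝ)..(n * D), q t ≤ ∫ t in (0 : ℝ)..R, q t := by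
    rw [← intervalIntegral.integral_add_adjacent_intervals (hq 0 (n * D)) (hq (n * D) R)]
    have := intervalIntegral.integral_nonneg hle (μ := volume) (f := q) fun t _ => h0 t
    linarith
  have h2 : R / D - 1 ≤ n := by linarith [Nat.lt_floor_add_one (R / D)]
  calc _ ≤ (n : ℝ) * v := mul_le_mul_of_nonneg_right h2 hv
    _ ≤ _ := hsum.trans h1

theorem norm_intervalIntegral_le {h : ℝ → ℂ} {M : ℝ} (hM : ∀ t, ‖h t‖ ≤ M) (a b : ℝ) :
    ‖∫ t in a..b, h t‖ ≤ M * |b - a| :=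
  intervalIntegral.norm_integral_le_of_norm_le_const fun t _ => hM t

theorem norm_integral_le_of_blocks {h : ℝ → ℂ} (hc : Continuous h) {M b S : ℝ} (hS : 0 < S)
    (hM : ∀ t, ‖h t‖ ≤ M) (hb : ∀ a, ‖∫ t in a..a + S, h t‖ ≤ b) {R : ℝ} (hR : 0 ≤ R) :
    ‖∫ t in (0 : ℝ)..R, h t‖ ≤ R / S * b + M * S := by
  have hi : ∀ a b, IntervalIntegrable h volume a b := fun a b => hc.intervalIntegrable a b
  set n := ⌊R / S⌋₊ with hn
  have hb0 : 0 ≤ b := (norm_nonneg _).trans (hb 0)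
  have hM0 : 0 ≤ M := (norm_nonneg _).trans (hM 0)
  have hsum : ‖∫ t in (0 : ℝ)..(n * S), h t‖ ≤ n * b := by
    have := intervalIntegral.sum_integral_adjacent_intervals (f := h) (μ := volume)
      (a := fun k : ℕ => (k : ℝ) * S) (n := n) (fun k _ => hi _ _)
    simp only [Nat.cast_zero, zero_mul] at this
    rw [← this]
    refine (norm_sum_le _ _).trans ?_
    calc _ ≤ ∑ k ∈ Finset.range n, b := Finset.sum_le_sum fun k _ => by
          have := hb (k * S)
          rwa [show ((k + 1 : ℕ) : ℝ) * S = k * S + S by push_cast; ring]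
      _ = _ := by simp
  have hle : (n : ℝ) * S ≤ R := by
    rw [← le_div_iff₀ hS]; exact Nat.floor_le (by positivity)
  have hlt : R ≤ n * S + S := by
    have := (div_lt_iff₀ hS).1 (Nat.lt_floor_add_one (R / S))
    rw [← hn] at this; linarith
  rw [← intervalIntegral.integral_add_adjacent_intervals (hi 0 (n * S)) (hi (n * S) R)]
  refine (norm_add_le _ _).trans (add_le_add (hsum.trans ?_) ?_)
  · exact mul_le_mul_of_nonneg_right (Nat.floor_le (by positivity)) hb0
  · refine (norm_intervalIntegral_le hM _ _).trans (mul_le_mul_of_nonneg_left ?_ hM0)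
    rw [abs_of_nonneg (by linarith)]; linarith

/-! ### Means against characters, uniformly in the frequency -/

/-- The symmetric means of `h` tend to zero along some sequence of lengths. -/
def MeanSmall (h : ℝ → ℂ) : Prop :=
  ∀ η > 0, ∀ S₀ : ℝ, ∃ S ≥ S₀, ‖∫ t in (-S)..S, h t‖ ≤ η * S

theorem norm_mul_character_le {h : ℝ → ℂ} {M : ℝ} (hM : ∀ t, ‖h t‖ ≤ M) (μ t : ℝ) :
    ‖h t * character μ t‖ ≤ M := by
  rw [norm_mul, norm_character, mul_one]; exact hM t

/-- One long symmetric interval with a small mean controls all intervals of its length: a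
translation number close to the centre of the target interval carries one to the other, up to end
pieces of length at most `d`. -/
theorem IsBohrAP.exists_uniform_block {h : ℝ → ℂ} (hh : IsBohrAP h) {μ : ℝ}
    (hμ : MeanSmall fun t => h t * character μ t) {η : ℝ} (hη : 0 < η) :
    ∃ S > 0, ∀ a, ‖∫ t in a..a + S, h t * character μ t‖ ≤ η * S := by
  obtain ⟨M, hM0, hM⟩ := hh.exists_bound
  obtain ⟨d, hd, hD⟩ := hh.exists_translation (half_pos hη)
  have hc : Continuous fun t => h t * character μ t := hh.continuous.mul (continuous_character μ)
  have hi : ∀ a b, IntervalIntegrable (fun t => h t * character μ t) volume a b :=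
    fun a b => hc.intervalIntegrable a b
  have hM' := norm_mul_character_le hM μ
  -- The second bound on `S` makes the two end pieces, at most `2 * M * d` together, cost no more
  -- than `η * S / 2`.
  obtain ⟨S, hS, hSm⟩ := hμ (η / 2) (half_pos hη) (max 1 (4 * M * d / η))
  have hS1 : 1 ≤ S := (le_max_left _ _).trans hS
  have hS2 : 4 * M * d ≤ S * η := (div_le_iff₀ hη).1 ((le_max_right _ _).trans hS)
  refine ⟨2 * S, by linarith, fun a => ?_⟩
  obtain ⟨τ, ⟨hτ1, hτ2⟩, hτ⟩ := hD (a + S)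
  have e1 : ∫ t in (τ - S)..(τ + S), h t * character μ t
      = character μ τ * ∫ t in (-S)..S, h (t + τ) * character μ t := by
    rw [← intervalIntegral.integral_const_mul,
      show τ - S = -S + τ by ring, show τ + S = S + τ by ring,
      ← intervalIntegral.integral_comp_add_right (fun t => h t * character μ t)]
    refine intervalIntegral.integral_congr fun t _ => ?_
    rw [character_add]; ring
  have e2 : ‖∫ t in (τ - S)..(τ + S), h t * character μ t‖ ≤ η / 2 * S + η / 2 * (2 * S) := by
    rw [e1, norm_mul, norm_character, one_mul]
    have hc2 : Continuous fun t => h (t + τ) * character μ t :=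
      (hh.continuous.comp (continuous_add_const τ)).mul (continuous_character μ)
    have : ∫ t in (-S)..S, h (t + τ) * character μ t = (∫ t in (-S)..S, h t * character μ t)
        + ∫ t in (-S)..S, (h (t + τ) - h t) * character μ t := by
      rw [← intervalIntegral.integral_add (hi _ _)
        (Continuous.intervalIntegrable (by
          have := hh.continuous
          fun_prop) _ _)]
      refine intervalIntegral.integral_congr fun t _ => ?_
      ring
    rw [this]
    refine (norm_add_le _ _).trans (add_le_add hSm ?_)
    have := norm_intervalIntegral_le (h := fun t => (h (t + τ) - h t) * character μ t)
      (norm_mul_character_le hτ μ) (-S) S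
    rwa [show S - -S = 2 * S by ring, abs_of_nonneg (by linarith)] at this
  have e3 : ∫ t in a..a + 2 * S, h t * character μ t
      = (∫ t in a..(τ - S), h t * character μ t) + (∫ t in (τ - S)..(τ + S), h t * character μ t)
        + ∫ t in (τ + S)..(a + 2 * S), h t * character μ t := by
    rw [intervalIntegral.integral_add_adjacent_intervals (hi _ _) (hi _ _),
      intervalIntegral.integral_add_adjacent_intervals (hi _ _) (hi _ _)]
  have e4 := norm_intervalIntegral_le hM' a (τ - S)
  have e5 := norm_intervalIntegral_le hM' (τ + S) (a + 2 * S)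
  rw [abs_of_nonneg (by linarith)] at e4
  rw [abs_of_nonpos (by linarith)] at e5
  have e6 : M * (τ - S - a) ≤ M * d := mul_le_mul_of_nonneg_left (by linarith) hM0.le
  have e7 : M * -(a + 2 * S - (τ + S)) ≤ M * d := mul_le_mul_of_nonneg_left (by linarith) hM0.le
  rw [e3]
  refine (norm_add₃_le).trans ?_
  linarith

/-- On a block of fixed length `S`, the characters of nearby frequencies `ν` and `μ` nearly agree up
to a unimodular constant depending on the block. The block estimate at `μ` thus passes to `ν`, and
summing blocks gives all large `T` at once. -/
theorem IsBohrAP.eventually_locally {h : ℝ → ℂ} (hh : IsBohrAP h) {μ : ℝ}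
    (hμ : MeanSmall fun t => h t * character μ t) {η : ℝ} (hη : 0 < η) :
    ∀ᶠ p : ℝ × ℝ in 𝓝 μ ×ˢ atTop, ‖∫ t in (0 : ℝ)..p.2, h t * character p.1 t‖ ≤ η * p.2 := by
  obtain ⟨M, hM0, hM⟩ := hh.exists_bound
  obtain ⟨S, hS, hSb⟩ := hh.exists_uniform_block hμ (show 0 < η / 3 by positivity)
  have hc : ∀ ν, Continuous fun t => h t * character ν t :=
    fun ν => hh.continuous.mul (continuous_character ν)
  have hev : ∀ᶠ p : ℝ × ℝ in 𝓝 μ ×ˢ atTop,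
      |p.1 - μ| < η / (3 * M * S) ∧ max 0 (3 * M * S / η) ≤ p.2 := by
    refine Eventually.prod_mk (pa := fun x : ℝ => |x - μ| < η / (3 * M * S)) ?_
      (eventually_ge_atTop _)
    have := Metric.ball_mem_nhds μ (show 0 < η / (3 * M * S) by positivity)
    filter_upwards [this] with x hx
    simpa [Real.dist_eq] using hx
  filter_upwards [hev] with ⟨ν, T⟩ ⟨hν, hT⟩
  simp only at hν hT ⊢
  have hT0 : 0 ≤ T := (le_max_left _ _).trans hT
  have hT1 : 3 * M * S ≤ T * η := (div_le_iff₀ hη).1 ((le_max_right _ _).trans hT)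
  have hblock : ∀ a, ‖∫ t in a..a + S, h t * character ν t‖ ≤ 2 * η / 3 * S := by
    intro a
    have e1 : ∫ t in a..a + S, h t * character ν t
        = character (ν - μ) a * ((∫ t in a..a + S, h t * character μ t)
          + ∫ t in a..a + S, h t * character μ t * (character (ν - μ) (t - a) - 1)) := by
      rw [← intervalIntegral.integral_add ((hc μ).intervalIntegrable _ _)
        (Continuous.intervalIntegrable (by have := hc μ; fun_prop) _ _),
        ← intervalIntegral.integral_const_mul]
      refine intervalIntegral.integral_congr fun t _ => ?_
      have : character ν t = character (ν - μ) a * character μ t * character (ν - μ) (t - a) := by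
        rw [mul_right_comm, ← character_add, add_sub_cancel, ← character_add_left, sub_add_cancel]
      simp only [this]; ring
    rw [e1, norm_mul, norm_character, one_mul]
    refine (norm_add_le _ _).trans ?_
    have e2 : ‖∫ t in a..a + S, h t * character μ t * (character (ν - μ) (t - a) - 1)‖
        ≤ M * (η / (3 * M * S) * S) * |a + S - a| := by
      refine intervalIntegral.norm_integral_le_of_norm_le_const fun t ht => ?_
      rw [Set.uIoc_of_le (by linarith)] at ht
      rw [norm_mul]
      refine mul_le_mul (norm_mul_character_le hM μ t)
        ((norm_character_sub_one_le _ _).trans ?_) (norm_nonneg _) hM0.le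
      rw [abs_mul]
      refine mul_le_mul hν.le ?_ (abs_nonneg _) (by positivity)
      rw [abs_of_nonneg (by linarith [ht.1])]; linarith [ht.2]
    have e3 : M * (η / (3 * M * S) * S) * |a + S - a| = η / 3 * S := by
      rw [add_sub_cancel_left, abs_of_pos hS]; field_simp
    have := hSb a
    linarith
  have := norm_integral_le_of_blocks (hc ν) hS (norm_mul_character_le hM ν) hblock hT0
  have e : T / S * (2 * η / 3 * S) = 2 * η / 3 * T := by field_simp
  linarith

/-- The Riemann–Lebesgue argument: a shift by the half-period `π / μ` reverses the sign of the
character, so twice the integral is the integral of `h t - h (t + π / μ)` against it, up to two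
short end pieces. Uniform continuity makes this small. -/
theorem IsBohrAP.eventually_large {h : ℝ → ℂ} (hh : IsBohrAP h) {η : ℝ} (hη : 0 < η) :
    ∃ B > 0, ∀ᶠ T : ℝ in atTop, ∀ μ, B ≤ |μ| → ‖∫ t in (0 : ℝ)..T, h t * character μ t‖ ≤ η * T := by
  obtain ⟨M, hM0, hM⟩ := hh.exists_bound
  obtain ⟨δ, hδ, hD⟩ := hh.exists_delta hη
  refine ⟨2 * Real.pi / δ, by positivity, ?_⟩
  filter_upwards [eventually_ge_atTop (max 0 (2 * M * δ / η))] with T hT μ hμ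
  have hT0 : 0 ≤ T := (le_max_left _ _).trans hT
  have hT1 : 2 * M * δ ≤ T * η := (div_le_iff₀ hη).1 ((le_max_right _ _).trans hT)
  have hμ0 : 0 < |μ| := lt_of_lt_of_le (by positivity) hμ
  have hμne : μ ≠ 0 := abs_pos.1 hμ0
  set p := Real.pi / μ with hp
  have hpδ : |p| ≤ δ / 2 := by
    rw [hp, abs_div, abs_of_pos Real.pi_pos, div_le_iff₀ hμ0]
    rw [div_le_iff₀ hδ] at hμ
    linarith
  have hchar : character μ p = -1 := by
    rw [character, hp, mul_div_cancel₀ _ hμne, Complex.exp_pi_mul_I]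
  have hc : Continuous fun t => h t * character μ t := hh.continuous.mul (continuous_character μ)
  have hi : ∀ a b, IntervalIntegrable (fun t => h t * character μ t) volume a b :=
    fun a b => hc.intervalIntegrable a b
  have hM' := norm_mul_character_le hM μ
  have e1 : ∫ t in p..(T + p), h t * character μ t
      = -∫ t in (0 : ℝ)..T, h (t + p) * character μ t := by
    have := intervalIntegral.integral_comp_add_right (a := 0) (b := T)
      (fun t => h t * character μ t) p
    rw [zero_add] at this
    rw [← this, ← intervalIntegral.integral_neg]
    refine intervalIntegral.integral_congr fun t _ => ?_
    rw [character_add, hchar]; ring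
  have e2 : ∫ t in (0 : ℝ)..T, h t * character μ t
      = (∫ t in (0 : ℝ)..p, h t * character μ t) + (∫ t in p..(T + p), h t * character μ t)
        + ∫ t in (T + p)..T, h t * character μ t := by
    rw [intervalIntegral.integral_add_adjacent_intervals (hi _ _) (hi _ _),
      intervalIntegral.integral_add_adjacent_intervals (hi _ _) (hi _ _)]
  have hc2 : Continuous fun t => h (t + p) * character μ t :=
    (hh.continuous.comp (continuous_add_const p)).mul (continuous_character μ)
  have e3 : (∫ t in (0 : ℝ)..T, h t * character μ t) - (∫ t in (0 : ℝ)..T, h (t + p) * character μ t)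
      = ∫ t in (0 : ℝ)..T, (h t - h (t + p)) * character μ t := by
    rw [← intervalIntegral.integral_sub (hi _ _) (hc2.intervalIntegrable _ _)]
    refine intervalIntegral.integral_congr fun t _ => ?_
    ring
  have e4 : ‖∫ t in (0 : ℝ)..T, (h t - h (t + p)) * character μ t‖ ≤ η * |T - 0| := by
    refine norm_intervalIntegral_le (h := fun t => (h t - h (t + p)) * character μ t)
      (norm_mul_character_le (fun t => (hD _ _ ?_).le) μ) _ _
    rw [sub_add_cancel_left, abs_neg]; linarith
  rw [sub_zero, abs_of_nonneg hT0, ← e3] at e4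
  have e5 := norm_intervalIntegral_le hM' 0 p
  have e6 := norm_intervalIntegral_le hM' (T + p) T
  rw [sub_zero] at e5
  rw [sub_add_cancel_left, abs_neg] at e6
  have e7 : M * |p| ≤ M * (δ / 2) := mul_le_mul_of_nonneg_left hpδ hM0.le
  have e8 : (2 : ℂ) * ∫ t in (0 : ℝ)..T, h t * character μ t
      = ((∫ t in (0 : ℝ)..T, h t * character μ t) - (∫ t in (0 : ℝ)..T, h (t + p) * character μ t))
        + (∫ t in (0 : ℝ)..p, h t * character μ t)
        + ∫ t in (T + p)..T, h t * character μ t := by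
    rw [e1] at e2
    linear_combination e2
  have e9 := congrArg norm e8
  rw [norm_mul, Complex.norm_ofNat] at e9
  have e10 := norm_add₃_le (a := (∫ t in (0 : ℝ)..T, h t * character μ t)
    - (∫ t in (0 : ℝ)..T, h (t + p) * character μ t))
    (b := ∫ t in (0 : ℝ)..p, h t * character μ t) (c := ∫ t in (T + p)..T, h t * character μ t)
  have e11 : 0 ≤ η * T := by positivity
  linarith

/-- Compactness of `[-B, B]` globalizes the local estimate; larger frequencies need no hypothesis on
the means. -/
theorem IsBohrAP.eventually_uniform {h : ℝ → ℂ} (hh : IsBohrAP h)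
    (hμ : ∀ μ, MeanSmall fun t => h t * character μ t) {η : ℝ} (hη : 0 < η) :
    ∀ᶠ T : ℝ in atTop, ∀ μ, ‖∫ t in (0 : ℝ)..T, h t * character μ t‖ ≤ η * T := by
  obtain ⟨B, -, hB⟩ := hh.eventually_large hη
  have h1 : ∀ᶠ T : ℝ in atTop, ∀ μ ∈ Set.Icc (-B) B,
      ‖∫ t in (0 : ℝ)..T, h t * character μ t‖ ≤ η * T := by
    refine (isCompact_Icc (a := -B) (b := B)).induction_on
      (p := fun s => ∀ᶠ T : ℝ in atTop, ∀ μ ∈ s,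
        ‖∫ t in (0 : ℝ)..T, h t * character μ t‖ ≤ η * T) (by simp) ?_ ?_ fun μ _ => ?_
    · exact fun s t hst ht => ht.mono fun T hT μ hμ => hT μ (hst hμ)
    · intro s t hs ht
      filter_upwards [hs, ht] with T h1 h2 μ hμ
      exact hμ.elim (h1 μ) (h2 μ)
    · obtain ⟨p, hp, q, hq, hpq⟩ := Filter.eventually_prod_iff.1 (hh.eventually_locally (hμ μ) hη)
      exact ⟨{x | p x}, mem_nhdsWithin_of_mem_nhds hp, hq.mono fun T hT ν hν => hpq hν hT⟩
  filter_upwards [h1, hB] with T hT1 hT2 μ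
  rcases le_or_gt B |μ| with h | h
  · exact hT2 μ h
  · exact hT1 μ (abs_le.1 h.le)

/-! ### Energy of the autocorrelation -/

open scoped FourierTransform ComplexConjugate

/-- Since `f` lives on one period, its Fourier coefficients are samples of its Fourier transform, so
Parseval for series can be combined with the convolution theorem on the line. -/
theorem fourierCoeffOn_eq_fourier {f : ℝ → ℂ} {T : ℝ} (hT : 0 < T)
    (hf : ∀ t, t ∉ Set.Ioc (-T) T → f t = 0) (n : ℤ) :
    fourierCoeffOn (show -T < T by linarith) f n = (1 / (2 * T)) • 𝓕 f (n / (2 * T)) := by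
  rw [fourierCoeffOn_eq_integral, Real.fourier_real_eq_integral_exp_smul,
    show T - -T = 2 * T by ring, intervalIntegral.integral_of_le (by linarith)]
  congr 1
  rw [setIntegral_eq_integral_of_forall_compl_eq_zero fun t ht => by rw [hf t ht, smul_zero]]
  refine integral_congr_ae (ae_of_all _ fun t => ?_)
  simp only [fourier_coe_apply]
  congr 2
  push_cast
  ring

/-- The autocorrelation of `G`. -/
noncomputable def autocorrelation (G : ℝ → ℂ) : ℝ → ℂ :=
  MeasureTheory.convolution G (fun u => conj (G (-u))) (ContinuousLinearMap.mul ℂ ℂ) volume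

theorem autocorrelation_apply (G : ℝ → ℂ) (x : ℝ) :
    autocorrelation G x = ∫ t, G t * conj (G (t - x)) := by
  simp [autocorrelation, MeasureTheory.convolution]

theorem fourier_conj_neg (G : ℝ → ℂ) (ξ : ℝ) :
    𝓕 (fun u => conj (G (-u))) ξ = conj (𝓕 G ξ) := by
  rw [Real.fourier_real_eq_integral_exp_smul, Real.fourier_real_eq_integral_exp_smul, ← integral_conj,
    ← integral_neg_eq_self (μ := volume)]
  refine integral_congr_ae (ae_of_all _ fun t => ?_)
  simp only [neg_neg, smul_eq_mul, map_mul, ← Complex.exp_conj]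
  congr 2
  simp [Complex.conj_ofNat]

theorem norm_fourier_autocorrelation {G : ℝ → ℂ} (hG : Integrable G) (ξ : ℝ) :
    ‖𝓕 (autocorrelation G) ξ‖ = ‖𝓕 G ξ‖ ^ 2 := by
  have hG' : Integrable fun u => conj (G (-u)) :=
    (Complex.conjLIE.toContinuousLinearEquiv.toContinuousLinearMap.integrable_comp hG.comp_neg)
  rw [autocorrelation, Real.fourier_mul_convolution_eq hG hG', fourier_conj_neg, norm_mul,
    RCLike.norm_conj, sq]

theorem integrable_of_bound_of_support {G : ℝ → ℂ} {T M : ℝ}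
    (hm : Measurable G) (hM : ∀ t, ‖G t‖ ≤ M) (hsupp : ∀ t, t ∉ Set.Ioc 0 T → G t = 0) :
    Integrable G := by
  have : IntegrableOn G (Set.Ioc 0 T) :=
    Measure.integrableOn_of_bounded (by simp) hm.aestronglyMeasurable (ae_of_all _ hM)
  exact this.integrable_of_forall_notMem_eq_zero hsupp

theorem integrable_autocorrelation {G : ℝ → ℂ} (hG : Integrable G) :
    Integrable (autocorrelation G) :=
  hG.integrable_convolution (ContinuousLinearMap.mul ℂ ℂ)
    (Complex.conjLIE.toContinuousLinearEquiv.toContinuousLinearMap.integrable_comp hG.comp_neg)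

theorem norm_autocorrelation_le {G : ℝ → ℂ} {M : ℝ} (hG : Integrable G) (hM : ∀ t, ‖G t‖ ≤ M)
    (t : ℝ) : ‖autocorrelation G t‖ ≤ ∫ s, ‖G s‖ * M := by
  rw [autocorrelation_apply]
  refine norm_integral_le_of_norm_le (hG.norm.mul_const M) (ae_of_all _ fun s => ?_)
  rw [norm_mul, RCLike.norm_conj]
  exact mul_le_mul_of_nonneg_left (hM _) (norm_nonneg _)

/-- Parseval on `(-T, T]`, which carries both `G` and its autocorrelation: the transform of the
latter has modulus `‖𝓕 G‖ ^ 2`, and `‖𝓕 G‖ ^ 4 ≤ A ^ 2 * ‖𝓕 G‖ ^ 2` term by term. -/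
theorem integral_autocorrelation_le {G : ℝ → ℂ} {T M A : ℝ} (hT : 0 < T)
    (hm : Measurable G) (hM : ∀ t, ‖G t‖ ≤ M) (hsupp : ∀ t, t ∉ Set.Ioc 0 T → G t = 0)
    (hA : ∀ ξ, ‖𝓕 G ξ‖ ≤ A) :
    ∫ t in (-T)..T, ‖autocorrelation G t‖ ^ 2 ≤ A ^ 2 * ∫ t in (-T)..T, ‖G t‖ ^ 2 := by
  have hA0 : 0 ≤ A := (norm_nonneg _).trans (hA 0)
  have hG : Integrable G := integrable_of_bound_of_support hm hM hsupp
  have hgi := integrable_autocorrelation hG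
  have hgb := norm_autocorrelation_le hG hM
  have hgsupp : ∀ t, t ∉ Set.Ioc (-T) T → autocorrelation G t = 0 := fun t ht => by
    rw [autocorrelation_apply]
    refine integral_eq_zero_of_ae (ae_of_all _ fun s => ?_)
    by_cases hs : s ∈ Set.Ioc 0 T
    · have : s - t ∉ Set.Ioc 0 T := fun h => ht ⟨by linarith [h.2, hs.1], by linarith [h.1, hs.2]⟩
      simp [hsupp _ this]
    · simp [hsupp _ hs]
  have hGsupp : ∀ t, t ∉ Set.Ioc (-T) T → G t = 0 := fun t ht =>
    hsupp t fun h => ht ⟨by linarith [h.1], h.2⟩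
  have hLp : ∀ (f : ℝ → ℂ) (C : ℝ), AEStronglyMeasurable f volume → (∀ t, ‖f t‖ ≤ C) →
      MemLp f 2 (volume.restrict (Set.Ioc (-T) T)) := fun f C hf hC =>
    MemLp.of_bound hf.restrict C (ae_of_all _ hC)
  have p1 := hasSum_sq_fourierCoeffOn (show -T < T by linarith)
    (hLp _ _ hgi.aestronglyMeasurable hgb)
  have p2 := hasSum_sq_fourierCoeffOn (show -T < T by linarith)
    (hLp _ _ hG.aestronglyMeasurable hM)
  have hle := hasSum_le (fun n : ℤ => ?_) p1 (p2.mul_left (A ^ 2))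
  · rw [smul_eq_mul, smul_eq_mul, mul_left_comm] at hle
    exact le_of_mul_le_mul_left hle (by rw [inv_pos]; linarith)
  · rw [fourierCoeffOn_eq_fourier hT hgsupp, fourierCoeffOn_eq_fourier hT hGsupp, norm_smul,
      norm_smul, norm_fourier_autocorrelation hG, mul_pow, mul_pow, mul_left_comm]
    refine mul_le_mul_of_nonneg_left ?_ (by positivity)
    rw [← mul_pow, sq (‖𝓕 G _‖)]
    gcongr
    exact hA _

/-! ### The uniqueness theorem -/

theorem const_mul_le_integral {q : ℝ → ℝ} (hq : ∀ a b, IntervalIntegrable q volume a b)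
    (h0 : ∀ t, 0 ≤ q t) {a b x y v : ℝ} (hax : a ≤ x) (hxy : x ≤ y) (hyb : y ≤ b)
    (hv : ∀ t ∈ Set.Icc x y, v ≤ q t) : (y - x) * v ≤ ∫ t in a..b, q t := by
  have h1 : ∫ t in x..y, v ≤ ∫ t in x..y, q t :=
    intervalIntegral.integral_mono_on hxy (by simp) (hq _ _) hv
  have h2 : ∫ t in x..y, q t ≤ ∫ t in a..b, q t :=
    intervalIntegral.integral_mono_interval hax hxy hyb (ae_of_all _ h0) (hq _ _)
  rw [intervalIntegral.integral_const, smul_eq_mul] at h1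
  exact h1.trans h2

theorem exists_linear_lower_bound {q : ℝ → ℝ} (hq : ∀ a b, IntervalIntegrable q volume a b)
    (h0 : ∀ t, 0 ≤ q t) {D v : ℝ} (hD : 0 < D) (hv : 0 < v)
    (hb : ∀ a, v ≤ ∫ t in a..a + D, q t) :
    ∃ c > 0, ∀ᶠ R : ℝ in atTop, c * R ≤ ∫ t in (0 : ℝ)..R, q t := by
  refine ⟨v / (2 * D), by positivity, ?_⟩
  filter_upwards [eventually_ge_atTop (2 * D)] with R hR
  refine le_trans ?_ (le_integral_of_blocks hq h0 hD hv.le hb (by linarith))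
  have h1 : 2 ≤ R / D := by rwa [le_div_iff₀ hD]
  calc v / (2 * D) * R = (R / D - R / D / 2) * v := by field_simp; ring
    _ ≤ (R / D - 1) * v := by gcongr; linarith

/-- A nonzero value recurs: every interval of length `d + δ` contains one of length `δ` on which
`‖h‖ ≥ ‖h t₀‖ / 2`. -/
theorem IsBohrAP.exists_meanSquare_lower {h : ℝ → ℂ} (hh : IsBohrAP h) {t₀ : ℝ} (ht₀ : h t₀ ≠ 0) :
    ∃ c > 0, ∀ᶠ R : ℝ in atTop, c * R ≤ ∫ t in (0 : ℝ)..R, ‖h t‖ ^ 2 := by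
  have ha : 0 < ‖h t₀‖ := norm_pos_iff.2 ht₀
  obtain ⟨d, hd, hD⟩ := hh.exists_translation (show 0 < ‖h t₀‖ / 4 by positivity)
  obtain ⟨δ, hδ, hU⟩ := hh.exists_delta (show 0 < ‖h t₀‖ / 4 by positivity)
  have hq : ∀ a b, IntervalIntegrable (fun t => ‖h t‖ ^ 2) volume a b :=
    fun a b => (hh.continuous.norm.pow 2).intervalIntegrable a b
  refine exists_linear_lower_bound hq (fun t => by positivity) (D := d + δ) (by linarith)
    (v := δ * (‖h t₀‖ / 2) ^ 2) (by positivity) fun a => ?_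
  -- This starting point places the interval of length `δ` around `t₀ + τ` inside `[a, a + (d +
  -- δ)]`.
  obtain ⟨τ, ⟨hτ1, hτ2⟩, hτ⟩ := hD (a + δ / 2 - t₀)
  have := const_mul_le_integral hq (fun t => by positivity) (a := a) (b := a + (d + δ))
    (x := t₀ + τ - δ / 2) (y := t₀ + τ + δ / 2) (v := (‖h t₀‖ / 2) ^ 2) (by linarith)
    (by linarith) (by linarith) fun t ht => ?_
  · rwa [show t₀ + τ + δ / 2 - (t₀ + τ - δ / 2) = δ by ring] at this
  · have h1 := hτ (t - τ)
    rw [sub_add_cancel] at h1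
    have h2 := hU (t - τ) t₀ (by rw [abs_lt]; constructor <;> linarith [ht.1, ht.2])
    have h3 : ‖h t₀‖ ≤ ‖h t‖ + ‖h t - h (t - τ)‖ + ‖h (t - τ) - h t₀‖ := by
      have e : h t₀ = h t - (h t - h (t - τ)) - (h (t - τ) - h t₀) := by ring
      calc ‖h t₀‖ = ‖h t - (h t - h (t - τ)) - (h (t - τ) - h t₀)‖ := by rw [← e]
        _ ≤ _ := (norm_sub_le _ _).trans (add_le_add_left (norm_sub_le _ _) _)
    exact pow_le_pow_left₀ (by positivity) (by linarith) 2

/-- The `ε`-translation numbers of a function of a real variable. -/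
def lineTranslations (h : ℝ → ℂ) (ε : ℝ) : Set ℝ := {t | ∀ s, ‖h (s + t) - h s‖ ≤ ε}

theorem isClosed_lineTranslations {h : ℝ → ℂ} (hc : Continuous h) (ε : ℝ) :
    IsClosed (lineTranslations h ε) := by
  simp only [lineTranslations, Set.ofPred_forall]
  exact isClosed_iInter fun s => isClosed_le (by fun_prop) continuous_const

/-- Relative density alone says nothing about measure; uniform continuity fattens each `ε /
2`-translation number to an interval of `ε`-translation numbers, which gives positive lower density.
-/
theorem IsBohrAP.exists_translations_lower {h : ℝ → ℂ} (hh : IsBohrAP h) {ε : ℝ} (hε : 0 < ε) :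
    ∃ c > 0, ∀ᶠ R : ℝ in atTop,
      c * R ≤ ∫ t in (0 : ℝ)..R, (lineTranslations h ε).indicator (fun _ => (1 : ℝ)) t := by
  obtain ⟨d, hd, hD⟩ := hh.exists_translation (half_pos hε)
  obtain ⟨δ, hδ, hU⟩ := hh.exists_delta (half_pos hε)
  have hE := (isClosed_lineTranslations hh.continuous ε).measurableSet
  have hq : ∀ a b, IntervalIntegrable ((lineTranslations h ε).indicator fun _ => (1 : ℝ)) volume a b :=
    fun a b => ⟨(integrableOn_const (by simp)).indicator hE,
      (integrableOn_const (by simp)).indicator hE⟩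
  have h0 : ∀ t, 0 ≤ (lineTranslations h ε).indicator (fun _ => (1 : ℝ)) t :=
    fun t => Set.indicator_nonneg (fun _ _ => zero_le_one) t
  refine exists_linear_lower_bound hq h0 (D := d + δ) (by linarith) (v := δ) hδ fun a => ?_
  obtain ⟨τ, ⟨hτ1, hτ2⟩, hτ⟩ := hD (a + δ / 2)
  have := const_mul_le_integral hq h0 (a := a) (b := a + (d + δ))
    (x := τ - δ / 2) (y := τ + δ / 2) (v := 1) (by linarith) (by linarith) (by linarith)
    fun t ht => ?_
  · linarith
  · have hmem : t ∈ lineTranslations h ε := fun s => by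
      have h1 := hτ s
      have h2 := hU (s + t) (s + τ) (by
        rw [abs_lt]; constructor <;> linarith [ht.1, ht.2])
      have h3 := norm_sub_le_norm_sub_add_norm_sub (h (s + t)) (h (s + τ)) (h s)
      linarith
    rw [Set.indicator_of_mem hmem]

theorem autocorrelation_indicator {h : ℝ → ℂ} {T t : ℝ} (ht : 0 ≤ t) (htT : t ≤ T) :
    autocorrelation ((Set.Ioc 0 T).indicator h) t = ∫ s in (0 : ℝ)..(T - t), h (s + t) * conj (h s) := by
  rw [autocorrelation_apply, ← integral_add_right_eq_self _ t,
    intervalIntegral.integral_of_le (by linarith), ← integral_indicator measurableSet_Ioc]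
  refine integral_congr_ae (ae_of_all _ fun s => ?_)
  simp only [add_sub_cancel_right]
  by_cases hs : s ∈ Set.Ioc 0 (T - t)
  · rw [Set.indicator_of_mem hs, Set.indicator_of_mem, Set.indicator_of_mem]
    · exact ⟨hs.1, by linarith [hs.2]⟩
    · exact ⟨by linarith [hs.1], by linarith [hs.2]⟩
  · rw [Set.indicator_of_notMem hs]
    by_cases h1 : s ∈ Set.Ioc 0 T
    · rw [Set.indicator_of_notMem (a := s + t), zero_mul]
      exact fun h2 => hs ⟨h1.1, by linarith [h2.2]⟩
    · rw [Set.indicator_of_notMem h1, map_zero, mul_zero]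

/-- For a translation number `t` the integrand `h (s + t) * conj (h s)` is close to `‖h s‖ ^ 2`, and
`t ≤ T / 2` leaves an overlap of length at least `T / 2`. -/
theorem le_norm_autocorrelation {h : ℝ → ℂ} (hc : Continuous h) {M ε T t : ℝ}
    (hM : ∀ t, ‖h t‖ ≤ M) (ht : t ∈ Set.Icc 0 (T / 2)) (hε : t ∈ lineTranslations h ε) :
    (∫ s in (0 : ℝ)..(T / 2), ‖h s‖ ^ 2) - ε * M * T
      ≤ ‖autocorrelation ((Set.Ioc 0 T).indicator h) t‖ := by
  have hM0 : 0 ≤ M := (norm_nonneg _).trans (hM 0)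
  have hε0 : 0 ≤ ε := (norm_nonneg _).trans (hε 0)
  have hT : 0 ≤ T := by linarith [ht.1, ht.2]
  rw [autocorrelation_indicator ht.1 (by linarith [ht.2])]
  have e1 : ∫ s in (0 : ℝ)..(T - t), h (s + t) * conj (h s)
      = ((∫ s in (0 : ℝ)..(T - t), ‖h s‖ ^ 2 : ℝ) : ℂ)
        + ∫ s in (0 : ℝ)..(T - t), (h (s + t) - h s) * conj (h s) := by
    rw [← intervalIntegral.integral_ofReal, ← intervalIntegral.integral_add
      (Continuous.intervalIntegrable (by fun_prop) _ _)
      (Continuous.intervalIntegrable (by fun_prop) _ _)]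
    refine intervalIntegral.integral_congr fun s _ => ?_
    simp only [Complex.ofReal_pow, ← Complex.mul_conj']
    ring
  have e2 : ‖∫ s in (0 : ℝ)..(T - t), (h (s + t) - h s) * conj (h s)‖ ≤ ε * M * |T - t - 0| := by
    refine norm_intervalIntegral_le (fun s => ?_) _ _
    rw [norm_mul, RCLike.norm_conj]
    exact mul_le_mul (hε s) (hM s) (norm_nonneg _) hε0
  have e3 : ε * M * |T - t - 0| ≤ ε * M * T := by
    rw [sub_zero, abs_of_nonneg (by linarith [ht.2])]
    exact mul_le_mul_of_nonneg_left (by linarith [ht.1]) (by positivity)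
  have e4 : ∫ s in (0 : ℝ)..(T / 2), ‖h s‖ ^ 2 ≤ ∫ s in (0 : ℝ)..(T - t), ‖h s‖ ^ 2 :=
    intervalIntegral.integral_mono_interval le_rfl (by linarith) (by linarith [ht.2])
      (ae_of_all _ fun s => by positivity) ((hc.norm.pow 2).intervalIntegrable _ _)
  rw [e1]
  have e5 := norm_sub_le_norm_add ((∫ s in (0 : ℝ)..(T - t), ‖h s‖ ^ 2 : ℝ) : ℂ)
    (∫ s in (0 : ℝ)..(T - t), (h (s + t) - h s) * conj (h s))
  rw [Complex.norm_real, Real.norm_eq_abs] at e5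
  linarith [le_abs_self (∫ s in (0 : ℝ)..(T - t), ‖h s‖ ^ 2)]

/-- An almost periodic function whose means against all characters vanish is zero. -/
theorem IsBohrAP.eq_zero {h : ℝ → ℂ} (hh : IsBohrAP h)
    (hμ : ∀ μ, MeanSmall fun t => h t * character μ t) (t₀ : ℝ) : h t₀ = 0 := by
  by_contra ht₀
  obtain ⟨M, hM0, hM⟩ := hh.exists_bound
  obtain ⟨c, hc0, hc⟩ := hh.exists_meanSquare_lower ht₀
  -- With this tolerance the loss in `le_norm_autocorrelation` is `c * T / 4`, half of the
  -- mean-square bound `c * T / 2`.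
  obtain ⟨c', hc'0, hc'⟩ := hh.exists_translations_lower (show 0 < c / (4 * M) by positivity)
  -- Chosen so that the upper bound for the energy is `c ^ 2 * c' * T ^ 3 / 128`, against the lower
  -- bound with denominator `32`.
  set η := c * Real.sqrt c' / (16 * M) with hη
  have hη0 : 0 < η := by have := Real.sqrt_pos.2 hc'0; positivity
  have hhalf : Tendsto (fun T : ℝ => T / 2) atTop atTop := tendsto_id.atTop_div_const two_pos
  obtain ⟨T, hT1, hT2, hT3, hT0⟩ := ((hhalf.eventually hc).and ((hhalf.eventually hc').and
    ((hh.eventually_uniform hμ hη0).and (eventually_gt_atTop 0)))).exists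
  set G := (Set.Ioc 0 T).indicator h with hG
  have hGm : Measurable G := hh.continuous.measurable.indicator measurableSet_Ioc
  have hGM : ∀ t, ‖G t‖ ≤ M := fun t => by
    rw [hG]; exact (norm_indicator_le_norm_self _ _).trans (hM t)
  have hA : ∀ ξ, ‖𝓕 G ξ‖ ≤ η * T := fun ξ => by
    -- `𝓕` uses `e^{-2πiξt}`, which is the character of frequency `-2πξ`.
    refine le_trans (le_of_eq ?_) (hT3 (-2 * Real.pi * ξ))
    rw [Real.fourier_real_eq_integral_exp_smul, intervalIntegral.integral_of_le hT0.le,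
      ← integral_indicator measurableSet_Ioc]
    congr 1
    refine integral_congr_ae (ae_of_all _ fun s => ?_)
    by_cases hs : s ∈ Set.Ioc 0 T
    · simp only [hG, Set.indicator_of_mem hs, character, smul_eq_mul]
      rw [mul_comm]
      congr 4
      ring
    · simp only [hG, Set.indicator_of_notMem hs, smul_zero]
  have hsupp : ∀ t, t ∉ Set.Ioc 0 T → G t = 0 := fun t ht => Set.indicator_of_notMem ht _
  have hup := integral_autocorrelation_le hT0 hGm hGM hsupp hA
  have hGi : Integrable G := integrable_of_bound_of_support hGm hGM hsupp
  have hgi : ∀ a b, IntervalIntegrable (fun t => ‖autocorrelation G t‖ ^ 2) volume a b := by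
    intro a b
    rw [intervalIntegrable_iff]
    refine Measure.integrableOn_of_bounded (M := (∫ s, ‖G s‖ * M) ^ 2) (by simp [Set.uIoc])
      ((integrable_autocorrelation hGi).aestronglyMeasurable.norm.pow 2) (ae_of_all _ fun t => ?_)
    rw [norm_pow, norm_norm]
    exact pow_le_pow_left₀ (norm_nonneg _) (norm_autocorrelation_le hGi hGM t) 2
  have hlow : (c * T / 4) ^ 2 * (c' * (T / 2)) ≤ ∫ t in (-T)..T, ‖autocorrelation G t‖ ^ 2 := by
    have hE := (isClosed_lineTranslations hh.continuous (c / (4 * M))).measurableSet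
    calc _ ≤ (c * T / 4) ^ 2 * ∫ t in (0 : ℝ)..(T / 2),
          (lineTranslations h (c / (4 * M))).indicator (fun _ => (1 : ℝ)) t :=
          mul_le_mul_of_nonneg_left hT2 (by positivity)
      _ = ∫ t in (0 : ℝ)..(T / 2), (c * T / 4) ^ 2 *
          (lineTranslations h (c / (4 * M))).indicator (fun _ => (1 : ℝ)) t := by
          rw [intervalIntegral.integral_const_mul]
      _ ≤ ∫ t in (0 : ℝ)..(T / 2), ‖autocorrelation G t‖ ^ 2 := by
          refine intervalIntegral.integral_mono_on (by linarith)
            (IntervalIntegrable.const_mul ⟨(integrableOn_const (by simp)).indicator hE,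
              (integrableOn_const (by simp)).indicator hE⟩ _) (hgi _ _) fun t ht => ?_
          by_cases hmem : t ∈ lineTranslations h (c / (4 * M))
          · rw [Set.indicator_of_mem hmem, mul_one]
            refine pow_le_pow_left₀ (by positivity) ?_ 2
            refine le_trans ?_ (le_norm_autocorrelation hh.continuous hM ht hmem)
            have : c / (4 * M) * M * T = c * T / 4 := by field_simp
            rw [this]
            linarith
          · rw [Set.indicator_of_notMem hmem, mul_zero]
            positivity
      _ ≤ _ := intervalIntegral.integral_mono_interval (by linarith) (by linarith) (by linarith)
          (ae_of_all _ fun t => by positivity) (hgi _ _)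
  have hGsq : ∫ t in (-T)..T, ‖G t‖ ^ 2 ≤ M ^ 2 * (2 * T) := by
    have := intervalIntegral.norm_integral_le_of_norm_le_const (a := -T) (b := T)
      (f := fun t => ‖G t‖ ^ 2) (C := M ^ 2) fun t _ => by
        rw [norm_pow, norm_norm]
        exact pow_le_pow_left₀ (norm_nonneg _) (hGM t) 2
    rw [show T - -T = 2 * T by ring, abs_of_pos (by linarith)] at this
    exact (le_abs_self _).trans this
  have h1 : (c * T / 4) ^ 2 * (c' * (T / 2)) ≤ (η * T) ^ 2 * (M ^ 2 * (2 * T)) :=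
    hlow.trans (hup.trans (mul_le_mul_of_nonneg_left hGsq (by positivity)))
  have h2 : (η * T) ^ 2 * (M ^ 2 * (2 * T)) = c ^ 2 * c' * T ^ 3 / 128 := by
    rw [hη, mul_pow, div_pow, mul_pow, Real.sq_sqrt hc'0.le]
    field_simp
    norm_num
  have h3 : 0 < c ^ 2 * c' * T ^ 3 := by positivity
  rw [h2] at h1
  nlinarith

/-! ### Bounded analytic functions on the half-plane -/

theorem isOpen_halfPlane (κ : ℝ) : IsOpen (halfPlane κ) :=
  isOpen_lt continuous_const Complex.continuous_re

theorem convex_halfPlane (κ : ℝ) : Convex ℝ (halfPlane κ) := convex_halfSpace_re_gt κ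

theorem halfPlane_anti {κ κ' : ℝ} (h : κ ≤ κ') : halfPlane κ' ⊆ halfPlane κ :=
  fun _ hs => lt_of_le_of_lt h hs

theorem norm_ext_le (f : BoundedFun) (s : ℂ) : ‖ext f s‖ ≤ ‖f‖ := by
  by_cases hs : s ∈ halfPlane 0
  · rw [ext_of_mem f hs]; exact f.norm_coe_le_norm _
  · rw [ext_of_notMem f hs, norm_zero]; exact norm_nonneg _

theorem ext_sub (f g : BoundedFun) (s : ℂ) : ext (f - g) s = ext f s - ext g s := by
  by_cases hs : s ∈ halfPlane 0
  · simp [ext_of_mem _ hs]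
  · simp [ext_of_notMem _ hs]

theorem differentiableOn_ext {f : BoundedFun} (hf : f ∈ Hinf) :
    DifferentiableOn ℂ (ext f) (halfPlane 0) := hf

/-- Cauchy's estimate on the disc of radius `κ` about `s`, whose closure stays in the right
half-plane. -/
theorem Hinf.norm_deriv_le {f : BoundedFun} (hf : f ∈ Hinf) {κ : ℝ} (hκ : 0 < κ) {s : ℂ}
    (hs : s ∈ halfPlane κ) : ‖deriv (ext f) s‖ ≤ ‖f‖ / κ := by
  refine Complex.norm_deriv_le_of_forall_mem_sphere_norm_le hκ ?_ fun z _ => norm_ext_le f z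
  refine DifferentiableOn.diffContOnCl ((differentiableOn_ext hf).mono fun z hz => ?_)
  rw [closure_ball _ hκ.ne', Metric.mem_closedBall, dist_eq_norm] at hz
  have h1 := (abs_le.1 ((Complex.abs_re_le_norm (z - s)).trans hz)).1
  have h2 : κ < s.re := hs
  rw [Complex.sub_re] at h1
  show 0 < z.re
  linarith

theorem Hinf.lipschitz {f : BoundedFun} (hf : f ∈ Hinf) {κ : ℝ} (hκ : 0 < κ) {s t : ℂ}
    (hs : s ∈ halfPlane κ) (ht : t ∈ halfPlane κ) :
    ‖ext f t - ext f s‖ ≤ ‖f‖ / κ * ‖t - s‖ :=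
  (convex_halfPlane κ).norm_image_sub_le_of_norm_deriv_le
    (fun _ hz => (differentiableOn_ext hf).differentiableAt
      ((isOpen_halfPlane 0).mem_nhds (halfPlane_anti hκ.le hz)))
    (fun _ hz => Hinf.norm_deriv_le hf hκ hz) hs ht

theorem uniformContinuousOn_of_lipschitz {f : ℂ → ℂ} {S : Set ℂ} {L : ℝ}
    (h : ∀ s ∈ S, ∀ t ∈ S, ‖f t - f s‖ ≤ L * ‖t - s‖) : UniformContinuousOn f S := by
  refine Metric.uniformContinuousOn_iff.2 fun ε hε => ?_
  have hL : 0 < |L| + 1 := by positivity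
  refine ⟨ε / (|L| + 1), by positivity, fun s hs t ht hst => ?_⟩
  rw [dist_comm, dist_eq_norm] at hst ⊢
  calc ‖f t - f s‖ ≤ L * ‖t - s‖ := h s hs t ht
    _ ≤ (|L| + 1) * ‖t - s‖ := by gcongr; linarith [le_abs_self L]
    _ < ε := by rw [lt_div_iff₀ hL] at hst; linarith

theorem isClosed_Hinf : IsClosed (Hinf : Set BoundedFun) := by
  refine isClosed_of_closure_subset fun f hf => ?_
  obtain ⟨u, hu, hlim⟩ := mem_closure_iff_seq_limit.1 hf
  have : TendstoUniformlyOn (fun n => ext (u n)) (ext f) atTop (halfPlane 0) := by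
    refine Metric.tendstoUniformlyOn_iff.2 fun ε hε => ?_
    filter_upwards [Metric.tendsto_nhds.1 hlim ε hε] with n hn s _
    rw [dist_comm, dist_eq_norm, ← ext_sub]
    rw [dist_eq_norm] at hn
    exact (norm_ext_le _ _).trans_lt hn
  exact this.tendstoLocallyUniformlyOn.differentiableOn
    (Eventually.of_forall fun n => hu n) (isOpen_halfPlane 0)

/-! ### Almost periodicity on smaller half-planes, uniform limits -/

theorem AlmostPeriodicOn.of_approx {κ : ℝ} {f : ℂ → ℂ}
    (h : ∀ ε > 0, ∃ g, AlmostPeriodicOn κ g ∧ ∀ s ∈ halfPlane κ, ‖f s - g s‖ ≤ ε) :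
    AlmostPeriodicOn κ f := by
  refine ⟨?_, ?_, fun ε hε => ?_⟩
  · obtain ⟨g, hg, hfg⟩ := h 1 one_pos
    obtain ⟨M, hM⟩ := hg.bounded
    refine ⟨1 + M, fun s hs => ?_⟩
    have := norm_add_le (f s - g s) (g s)
    rw [sub_add_cancel] at this
    linarith [hfg s hs, hM s hs]
  · refine Metric.uniformContinuousOn_iff.2 fun ε hε => ?_
    obtain ⟨g, hg, hfg⟩ := h (ε / 4) (by positivity)
    obtain ⟨δ, hδ, hU⟩ := Metric.uniformContinuousOn_iff.1 hg.uniformContinuousOn (ε / 4)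
      (by positivity)
    refine ⟨δ, hδ, fun s hs t ht hst => ?_⟩
    have h1 := hU s hs t ht hst
    have h2 := hfg s hs
    have h3 := hfg t ht
    rw [← dist_eq_norm] at h2 h3
    have := dist_triangle4 (f s) (g s) (g t) (f t)
    rw [dist_comm (g t)] at this
    linarith
  · obtain ⟨g, hg, hfg⟩ := h (ε / 3) (by positivity)
    refine (hg.relativelyDense (ε / 3) (by positivity)).mono fun τ hτ s hs => ?_
    have h1 := hτ s hs
    have h2 := hfg s hs
    have h3 := hfg _ (add_I_mem hs τ)
    rw [← dist_eq_norm] at h1 h2 h3 ⊢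
    have := dist_triangle4 (f (s + Complex.I * τ)) (g (s + Complex.I * τ)) (g s) (f s)
    rw [dist_comm (g s)] at this
    linarith

/-- The power of `x` on the right edge is the reciprocal of the interpolation exponent at abscissa
`δ`, so the interpolated power of `x` is at least `1` from `δ` on. -/
theorem norm_le_of_three_lines {g : ℂ → ℂ} {l u δ A x : ℝ} (hl : l < δ) (hu : δ < u)
    (hd : DiffContOnCl ℂ g (Complex.HadamardThreeLines.verticalStrip l u))
    (hA : 0 < A) (hgA : ∀ s, ‖g s‖ ≤ A) (hx : 0 < x) (hx1 : x ≤ 1)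
    (hgu : ∀ s : ℂ, s.re = u → ‖g s‖ ≤ A * x ^ ((u - l) / (δ - l)))
    {s : ℂ} (hs : δ < s.re) (hsu : s.re ≤ u) : ‖g s‖ ≤ A * x := by
  have hθ : 0 < (δ - l) / (u - l) := div_pos (by linarith) (by linarith)
  have key := Complex.HadamardThreeLines.norm_le_interp_of_mem_verticalClosedStrip'
    (f := g) (z := s) (a := A) (b := A * x ^ ((u - l) / (δ - l))) (l := l) (u := u) (by linarith)
    ⟨by linarith, hsu⟩ hd ⟨A, by rintro _ ⟨z, -, rfl⟩; exact hgA z⟩ (fun z _ => hgA z)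
    (fun z hz => hgu z hz)
  refine key.trans ?_
  set θ := (s.re - l) / (u - l) with hθs
  have hx' : 0 < x ^ ((u - l) / (δ - l)) := Real.rpow_pos_of_pos hx _
  rw [Real.mul_rpow hA.le hx'.le, ← mul_assoc, ← Real.rpow_add hA, sub_add_cancel, Real.rpow_one,
    ← Real.rpow_mul hx.le]
  refine mul_le_mul_of_nonneg_left ?_ hA.le
  refine Real.rpow_le_self_of_le_one hx.le hx1 ?_
  rw [hθs, div_mul_div_comm, mul_comm (δ - l), mul_div_mul_left _ _ (by linarith : u - l ≠ 0) ,
    le_div_iff₀ (by linarith)]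
  linarith

/-- A translation number on a far half-plane, taken with a much smaller tolerance, is an
`ε`-translation number on `Re s > δ`: apply the three lines theorem to `f (s + iτ) - f s`, which is
bounded by `2 * ‖f‖` everywhere. -/
theorem Hap.almostPeriodicOn {f : BoundedFun} (hf : f ∈ Hap) {δ : ℝ} (hδ : 0 < δ) :
    AlmostPeriodicOn δ (ext f) := by
  obtain ⟨hfi, κ, hκ, hap⟩ := hf
  refine ⟨⟨‖f‖, fun s _ => norm_ext_le f s⟩,
    uniformContinuousOn_of_lipschitz fun s hs t ht => Hinf.lipschitz hfi hδ hs ht, fun ε hε => ?_⟩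
  set u := max κ δ + 1 with hu
  have hδu : δ < u := by have := le_max_right κ δ; linarith
  have hκu : κ < u := by have := le_max_left κ δ; linarith
  set A := 2 * ‖f‖ + 1 with hA
  have hA0 : 0 < A := by positivity
  set x := min (ε / A) 1 with hx
  have hx0 : 0 < x := lt_min (by positivity) one_pos
  have hx1 : x ≤ 1 := min_le_right _ _
  have hAx : A * x ≤ ε := by
    have : x ≤ ε / A := min_le_left _ _
    rwa [le_div_iff₀ hA0, mul_comm] at this
  have hsmall : A * x ^ ((u - δ / 2) / (δ - δ / 2)) ≤ A * x := by
    refine mul_le_mul_of_nonneg_left ?_ hA0.le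
    refine Real.rpow_le_self_of_le_one hx0.le hx1 ?_
    rw [le_div_iff₀ (by linarith)]; linarith
  refine (hap.relativelyDense (A * x ^ ((u - δ / 2) / (δ - δ / 2)))
    (mul_pos hA0 (Real.rpow_pos_of_pos hx0 _))).mono fun τ hτ s hs => ?_
  rcases le_or_gt s.re u with hsu | hsu
  · refine le_trans (norm_le_of_three_lines (g := fun s => ext f (s + Complex.I * τ) - ext f s)
      (l := δ / 2) (by linarith) hδu ?_ hA0 (fun z => ?_) hx0 hx1 (fun z hz => ?_) hs hsu) hAx
    · have hsub : closure (Complex.HadamardThreeLines.verticalStrip (δ / 2) u) ⊆ halfPlane 0 := by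
        refine (closure_minimal (t := {z : ℂ | δ / 2 ≤ z.re}) (fun z hz => hz.1.le)
          (isClosed_le continuous_const Complex.continuous_re)).trans fun z hz => ?_
        exact lt_of_lt_of_le (half_pos hδ) hz
      refine DifferentiableOn.diffContOnCl (DifferentiableOn.mono ?_ hsub)
      refine DifferentiableOn.sub ?_ (differentiableOn_ext hfi)
      exact (differentiableOn_ext hfi).comp (by fun_prop) fun z hz => add_I_mem hz τ
    · refine (norm_sub_le _ _).trans ?_
      linarith [norm_ext_le f z, norm_ext_le f (z + Complex.I * τ)]
    · exact hτ z (show κ < z.re by rw [hz]; exact hκu)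
  · exact (hτ s (hκu.trans hsu)).trans (hsmall.trans hAx)

/-- The abscissas `κ` of an approximating sequence might tend to infinity; `Hap.almostPeriodicOn`
lets all of them be replaced by `1`. -/
theorem isClosed_Hap : IsClosed (Hap : Set BoundedFun) := by
  refine isClosed_of_closure_subset fun f hf => ?_
  refine ⟨isClosed_Hinf.closure_subset_iff.2 (fun g hg => hg.1) hf, 1, one_pos,
    AlmostPeriodicOn.of_approx fun ε hε => ?_⟩
  obtain ⟨g, hg, hfg⟩ := Metric.mem_closure_iff.1 hf ε hε
  refine ⟨ext g, Hap.almostPeriodicOn hg one_pos, fun s _ => ?_⟩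
  rw [← ext_sub]
  rw [dist_eq_norm] at hfg
  exact (norm_ext_le _ _).trans hfg.le

theorem completeSpace_Hap : CompleteSpace Hap := isClosed_Hap.completeSpace_coe

/-! ### Almost periodicity of exponentials and characters. -/

theorem AlmostPeriodicOn.of_periodic {κ : ℝ} {f : ℂ → ℂ} {M p : ℝ} (hp : 0 < p)
    (hM : ∀ s ∈ halfPlane κ, ‖f s‖ ≤ M) (hu : UniformContinuousOn f (halfPlane κ))
    (hf : ∀ (k : ℤ) (s : ℂ), f (s + Complex.I * (k * p : ℝ)) = f s) : AlmostPeriodicOn κ f := by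
  refine ⟨⟨M, hM⟩, hu, fun ε hε => ⟨p, hp, fun a => ?_⟩⟩
  refine ⟨⌈a / p⌉ * p, fun s _ => ?_, ?_, ?_⟩
  · rw [hf, sub_self, norm_zero]; exact hε.le
  · rw [← div_le_iff₀ hp]; exact Int.le_ceil _
  · have := mul_lt_mul_of_pos_right (Int.ceil_lt_add_one (a / p)) hp
    rw [add_mul, div_mul_cancel₀ _ hp.ne', one_mul] at this
    exact this.le

theorem norm_exp_neg_mul_le {μ : ℝ} (hμ : 0 ≤ μ) {s : ℂ} (hs : 0 ≤ s.re) :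
    ‖Complex.exp (-(μ : ℂ) * s)‖ ≤ 1 := by
  rw [Complex.norm_exp, Real.exp_le_one_iff]
  simp only [neg_mul, Complex.neg_re, Complex.re_ofReal_mul]
  linarith [mul_nonneg hμ hs]

theorem almostPeriodicOn_exp {μ κ : ℝ} (hμ : 0 ≤ μ) (hκ : 0 ≤ κ) :
    AlmostPeriodicOn κ fun s => Complex.exp (-(μ : ℂ) * s) := by
  have hre : ∀ s ∈ halfPlane κ, 0 ≤ s.re := fun s hs => hκ.trans (le_of_lt hs)
  have hu : UniformContinuousOn (fun s => Complex.exp (-(μ : ℂ) * s)) (halfPlane κ) := by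
    refine uniformContinuousOn_of_lipschitz (L := μ) fun s hs t ht => ?_
    refine Convex.norm_image_sub_le_of_norm_hasDerivWithin_le
      (f := fun z => Complex.exp (-(μ : ℂ) * z))
      (f' := fun z => Complex.exp (-(μ : ℂ) * z) * -(μ : ℂ)) (fun z _ => ?_) (fun z hz => ?_)
      (convex_halfPlane κ) hs ht
    · exact (((hasDerivAt_id z).const_mul (-(μ : ℂ))).cexp.hasDerivWithinAt).congr_deriv (by simp)
    · rw [norm_mul, norm_neg, Complex.norm_real, Real.norm_of_nonneg hμ]
      exact mul_le_of_le_one_left hμ (norm_exp_neg_mul_le hμ (hre z hz))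
  rcases hμ.eq_or_lt with rfl | hμ'
  · exact AlmostPeriodicOn.of_periodic (M := 1) one_pos (fun s hs => norm_exp_neg_mul_le hμ (hre s hs))
      hu fun k s => by simp
  · refine AlmostPeriodicOn.of_periodic (M := 1) (p := 2 * Real.pi / μ) (by positivity)
      (fun s hs => norm_exp_neg_mul_le hμ (hre s hs)) hu fun k s => ?_
    have : -(μ : ℂ) * (s + Complex.I * (k * (2 * Real.pi / μ) : ℝ))
        = -(μ : ℂ) * s + (-k : ℤ) * (2 * Real.pi * Complex.I) := by
      have : (μ : ℂ) ≠ 0 := by exact_mod_cast hμ'.ne'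
      push_cast
      field_simp
      ring
    rw [this, Complex.exp_add, Complex.exp_int_mul_two_pi_mul_I, mul_one]

theorem norm_character_sub_le (μ s t : ℝ) : ‖character μ t - character μ s‖ ≤ |μ| * |t - s| := by
  have : character μ t - character μ s = character μ s * (character μ (t - s) - 1) := by
    rw [mul_sub, mul_one, ← character_add, add_sub_cancel]
  rw [this, norm_mul, norm_character, one_mul, ← abs_mul]
  exact norm_character_sub_one_le _ _

theorem isBohrAP_character (μ : ℝ) : IsBohrAP (character μ) := by
  have hu : UniformContinuousOn (fun s : ℂ => character μ s.im) (halfPlane 0) := by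
    refine uniformContinuousOn_of_lipschitz (L := |μ|) fun s _ t _ => ?_
    refine (norm_character_sub_le _ _ _).trans (mul_le_mul_of_nonneg_left ?_ (abs_nonneg _))
    rw [← Complex.sub_im]; exact Complex.abs_im_le_norm _
  rcases eq_or_ne μ 0 with rfl | hμ
  · exact AlmostPeriodicOn.of_periodic (M := 1) one_pos (fun s _ => (norm_character _ _).le)
      hu fun k s => by simp [character]
  · refine AlmostPeriodicOn.of_periodic (M := 1) (p := 2 * Real.pi / |μ|) (by positivity)
      (fun s _ => (norm_character _ _).le) hu fun k s => ?_
    have hone : ∀ k : ℤ, character μ (k * (2 * Real.pi / μ)) = 1 := fun k => by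
      have : ((μ * (k * (2 * Real.pi / μ)) : ℝ) : ℂ) * Complex.I = k * (2 * Real.pi * Complex.I) := by
        have : (μ : ℂ) ≠ 0 := by exact_mod_cast hμ
        push_cast
        field_simp
      rw [character, this, Complex.exp_int_mul_two_pi_mul_I]
    have him : (s + Complex.I * (k * (2 * Real.pi / |μ|) : ℝ)).im = s.im + k * (2 * Real.pi / |μ|) := by
      simp
    rw [him, character_add]
    rcases abs_choice μ with h | h
    · rw [h, hone, mul_one]
    · have := hone (-k)
      rw [h, show (k : ℝ) * (2 * Real.pi / -μ) = (-k : ℤ) * (2 * Real.pi / μ) by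
        push_cast; field_simp, this, mul_one]

/-! ### Moving the line of integration -/

theorem norm_bohrIntegrand_le (f : BoundedFun) (μ : ℝ) (s : ℂ) :
    ‖ext f s * Complex.exp (μ * s)‖ ≤ ‖f‖ * Real.exp (μ * s.re) := by
  rw [norm_mul, Complex.norm_exp, Complex.re_ofReal_mul]
  exact mul_le_mul_of_nonneg_right (norm_ext_le f s) (Real.exp_pos _).le

/-- Cauchy's theorem on the rectangle between the two lines: the horizontal sides are bounded
independently of `T` and are then divided by `2 * T`. -/
theorem norm_bohrMean_sub_le {f : BoundedFun} (hf : f ∈ Hinf) {μ σ σ' : ℝ} (hσ : 0 < σ)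
    (hσ' : 0 < σ') {T : ℝ} (hT : 0 < T) :
    ‖bohrMean f μ σ' T - bohrMean f μ σ T‖
      ≤ ‖f‖ * Real.exp (|μ| * max σ σ') * |σ' - σ| * T⁻¹ := by
  set F : ℂ → ℂ := fun s => ext f s * Complex.exp (μ * s) with hF
  have hd : DifferentiableOn ℂ F (halfPlane 0) :=
    (differentiableOn_ext hf).mul (by fun_prop)
  have hb : ∀ x ∈ Set.uIoc σ σ', ∀ y : ℝ, ‖F (x + y * Complex.I)‖
      ≤ ‖f‖ * Real.exp (|μ| * max σ σ') := fun x hx y => by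
    refine (norm_bohrIntegrand_le f μ _).trans ?_
    have hx0 : 0 < x := (lt_min hσ hσ').trans hx.1
    have hre : ((x : ℂ) + y * Complex.I).re = x := by simp
    rw [hre]
    gcongr
    · exact le_abs_self μ
    · exact hx.2
  have rect := Complex.integral_boundary_rect_eq_zero_of_differentiableOn F
    (σ + (-T : ℝ) * Complex.I) (σ' + (T : ℝ) * Complex.I) (hd.mono fun z hz => by
      have h1 : z.re ∈ Set.uIcc σ σ' := by simpa using hz.1
      exact (lt_min hσ hσ').trans_le h1.1)
  simp only [Complex.add_re, Complex.ofReal_re, Complex.mul_re, Complex.I_re, mul_zero,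
    Complex.ofReal_im, Complex.I_im, mul_one, sub_self, add_zero, Complex.add_im, Complex.mul_im,
    zero_add] at rect
  have h1 := intervalIntegral.norm_integral_le_of_norm_le_const (f := fun x : ℝ => F (x + (-T : ℝ) * Complex.I))
    fun x hx => hb x hx (-T)
  have h2 := intervalIntegral.norm_integral_le_of_norm_le_const (f := fun x : ℝ => F (x + (T : ℝ) * Complex.I))
    fun x hx => hb x hx T
  have hmean : ∀ ρ : ℝ, bohrMean f μ ρ T
      = (1 / (2 * T) : ℂ) * ∫ y in (-T)..T, F (ρ + y * Complex.I) := fun ρ => by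
    simp only [bohrMean, hF, mul_comm Complex.I]
  rw [hmean, hmean, ← mul_sub]
  have h3 : Complex.I * ((∫ y in (-T)..T, F (σ' + y * Complex.I)) - ∫ y in (-T)..T, F (σ + y * Complex.I))
      = (∫ x in σ..σ', F (x + (T : ℝ) * Complex.I)) - ∫ x in σ..σ', F (x + (-T : ℝ) * Complex.I) := by
    simp only [smul_eq_mul] at rect
    linear_combination rect
  have h4 := congrArg norm h3
  rw [norm_mul, Complex.norm_I, one_mul] at h4
  rw [norm_mul, h4]
  have h5 := norm_sub_le (∫ x in σ..σ', F (x + (T : ℝ) * Complex.I))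
    (∫ x in σ..σ', F (x + (-T : ℝ) * Complex.I))
  have h6 : ‖(1 / (2 * T) : ℂ)‖ = T⁻¹ / 2 := by
    rw [norm_div, norm_mul, norm_one, Complex.norm_ofNat, Complex.norm_real, Real.norm_of_nonneg hT.le]
    field_simp
  rw [h6]
  calc _ ≤ T⁻¹ / 2 * (2 * (‖f‖ * Real.exp (|μ| * max σ σ') * |σ' - σ|)) := by
        gcongr; linarith
    _ = _ := by ring

theorem tendsto_bohrMean_sub {f : BoundedFun} (hf : f ∈ Hinf) {μ σ σ' : ℝ} (hσ : 0 < σ)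
    (hσ' : 0 < σ') : Tendsto (fun T => bohrMean f μ σ' T - bohrMean f μ σ T) atTop (𝓝 0) := by
  refine squeeze_zero_norm' ((eventually_gt_atTop 0).mono fun T hT =>
    norm_bohrMean_sub_le hf hσ hσ' hT) ?_
  simpa using (tendsto_inv_atTop_zero (𝕜 := ℝ)).const_mul (‖f‖ * Real.exp (|μ| * max σ σ') * |σ' - σ|)

theorem norm_bohrMean_le (f : BoundedFun) (μ σ : ℝ) {T : ℝ} (hT : 0 < T) :
    ‖bohrMean f μ σ T‖ ≤ ‖f‖ * Real.exp (μ * σ) := by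
  have h := intervalIntegral.norm_integral_le_of_norm_le_const (a := -T) (b := T)
    (f := fun t : ℝ => ext f (σ + Complex.I * t) * Complex.exp (μ * (σ + Complex.I * t)))
    (C := ‖f‖ * Real.exp (μ * σ)) fun t _ => by
      simpa using norm_bohrIntegrand_le f μ (σ + Complex.I * t)
  rw [show T - -T = 2 * T by ring, abs_of_pos (by linarith)] at h
  rw [bohrMean, norm_mul, norm_div, norm_mul, norm_one, Complex.norm_ofNat, Complex.norm_real,
    Real.norm_of_nonneg hT.le, one_div, inv_mul_le_iff₀ (by positivity)]
  linarith

/-- The means on `Re s = σ'` are at most `‖f‖ * e^{μσ'}`, which tends to `0` as the line moves to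
the right. -/
theorem HasBohrCoeff.zero_of_neg {f : BoundedFun} (hf : f ∈ Hinf) {μ : ℝ} (hμ : μ < 0) :
    HasBohrCoeff f μ 0 := fun σ hσ => by
  refine Metric.tendsto_nhds.2 fun ε hε => ?_
  have h1 : Tendsto (fun σ' : ℝ => ‖f‖ * Real.exp (μ * σ')) atTop (𝓝 0) := by
    simpa using (Real.tendsto_exp_atBot.comp
      (tendsto_id.const_mul_atTop_of_neg hμ)).const_mul ‖f‖
  obtain ⟨σ', h2, hσ'⟩ := ((h1.eventually (gt_mem_nhds (half_pos hε))).and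
    (eventually_gt_atTop 0)).exists
  filter_upwards [Metric.tendsto_nhds.1 (tendsto_bohrMean_sub hf (μ := μ) hσ' hσ) (ε / 2) (half_pos hε),
    eventually_gt_atTop 0] with T hT hT0
  rw [dist_zero_right] at hT ⊢
  have := norm_add_le (bohrMean f μ σ T - bohrMean f μ σ' T) (bohrMean f μ σ' T)
  rw [sub_add_cancel] at this
  linarith [norm_bohrMean_le f μ σ' hT0]

/-! ### Band-limited smoothing kernels -/

/-- `K` is the Fourier transform of a smooth bump equal to `1` near `0`. It is a Schwartz function,
so its first moment is finite, and Fourier inversion returns the compactly supported bump. -/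
theorem exists_bandlimited : ∃ (K : ℝ → ℂ) (X : ℝ), Integrable K ∧
    Integrable (fun u => |u| * ‖K u‖) ∧ ∫ u, K u = 1 ∧
    ∀ ξ, X ≤ |ξ| → ∫ u, K u * character ξ u = 0 := by
  let b : ContDiffBump (0 : ℝ) := ⟨1, 2, one_pos, one_lt_two⟩
  have hb1 : HasCompactSupport fun t : ℝ => (b t : ℂ) :=
    b.hasCompactSupport.comp_left (g := fun x : ℝ => (x : ℂ)) Complex.ofReal_zero
  have hb2 : ContDiff ℝ (⊤ : ℕ∞) fun t : ℝ => (b t : ℂ) :=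
    Complex.ofRealCLM.contDiff.comp b.contDiff
  let ψ : SchwartzMap ℝ ℂ := hb1.toSchwartzMap hb2
  let K : SchwartzMap ℝ ℂ := 𝓕 ψ
  have hψ : ∀ t, ψ t = b t := fun t => rfl
  have hinv : ∀ ξ : ℝ, ∫ u, K u * character (2 * Real.pi * ξ) u = b ξ := fun ξ => by
    have h1 : 𝓕⁻ (𝓕 ψ) = ψ := FourierTransform.fourierInv_fourier_eq ψ
    have h2 : (𝓕⁻ (𝓕 ψ)) ξ = ψ ξ := by rw [h1]
    rw [← hψ, ← h2, SchwartzMap.fourierInv_coe, Real.fourierInv_eq']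
    refine integral_congr_ae (ae_of_all _ fun u => ?_)
    simp only [character, smul_eq_mul, mul_comm (K u)]
    congr 3
    simp
    ring
  -- The bump vanishes at distance `2` from `0`; in angular frequency this is `2 * (2π)`.
  refine ⟨K, 4 * Real.pi, K.integrable, ?_, ?_, fun ξ hξ => ?_⟩
  · simpa using K.integrable_pow_mul volume 1
  · have := hinv 0
    rw [b.one_of_mem_closedBall (by simp [b])] at this
    simpa [character] using this
  · have := hinv (ξ / (2 * Real.pi))
    rw [mul_div_cancel₀ _ (by positivity)] at this
    rw [this, b.zero_of_le_dist, Complex.ofReal_zero]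
    rw [Real.dist_eq, sub_zero, abs_div, abs_of_pos (by positivity : 0 < 2 * Real.pi),
      le_div_iff₀ (by positivity)]
    show 2 * (2 * Real.pi) ≤ |ξ|
    linarith

/-- The rescaling `r * K (r * u)` keeps the integral, divides the first moment by `r` and widens the
band by the factor `r`. -/
theorem exists_kernel {η : ℝ} (hη : 0 < η) : ∃ (K : ℝ → ℂ) (X : ℝ), Integrable K ∧
    Integrable (fun u => |u| * ‖K u‖) ∧ ∫ u, K u = 1 ∧ ∫ u, |u| * ‖K u‖ ≤ η ∧
    ∀ ξ, X ≤ |ξ| → ∫ u, K u * character ξ u = 0 := by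
  obtain ⟨K, X, hi, hi1, h1, hX⟩ := exists_bandlimited
  set A := ∫ u, |u| * ‖K u‖ with hA
  have hA0 : 0 ≤ A := integral_nonneg fun u => by positivity
  set r := A / η + 1 with hr
  have hr0 : 0 < r := by positivity
  have habs : ∀ u, |u| * ‖(r : ℂ) * K (r * u)‖ = |r * u| * ‖K (r * u)‖ := fun u => by
    rw [norm_mul, Complex.norm_real, Real.norm_eq_abs, abs_mul]; ring
  refine ⟨fun u => r * K (r * u), r * X, (hi.comp_mul_left' hr0.ne').const_mul _, ?_,
    ?_, ?_, fun ξ hξ => ?_⟩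
  · simp only [habs]
    exact hi1.comp_mul_left' hr0.ne'
  · rw [integral_const_mul, Measure.integral_comp_mul_left, h1, abs_of_pos (inv_pos.2 hr0)]
    simp [hr0.ne']
  · simp only [habs]
    rw [Measure.integral_comp_mul_left (fun u => |u| * ‖K u‖), abs_of_pos (inv_pos.2 hr0), ← hA,
      smul_eq_mul, inv_mul_le_iff₀ hr0, hr, add_mul, div_mul_cancel₀ _ hη.ne']
    linarith
  · have : ∀ u, (r : ℂ) * K (r * u) * character ξ u
        = r * (fun v => K v * character (ξ / r) v) (r * u) := fun u => by
      simp only [character]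
      rw [show ξ / r * (r * u) = ξ * u by field_simp]
      ring
    simp only [this]
    rw [integral_const_mul, Measure.integral_comp_mul_left (fun v => K v * character (ξ / r) v),
      hX, smul_zero, mul_zero]
    rwa [abs_div, abs_of_pos hr0, le_div_iff₀ hr0, mul_comm]

/-- The convolution of `h` with the kernel `K`. -/
noncomputable def smoothing (K h : ℝ → ℂ) (t : ℝ) : ℂ := ∫ u, K u * h (t - u)

section Smoothing

variable {K h : ℝ → ℂ} {M : ℝ}

theorem integrable_smoothing (hK : Integrable K) (hc : Continuous h) (hM : ∀ t, ‖h t‖ ≤ M) (t : ℝ) :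
    Integrable fun u => K u * h (t - u) :=
  hK.mul_bdd (c := M) (Continuous.aestronglyMeasurable (by fun_prop)) (ae_of_all _ fun u => hM _)

theorem norm_smoothing_le (hK : Integrable K) (hM : ∀ t, ‖h t‖ ≤ M) (t : ℝ) :
    ‖smoothing K h t‖ ≤ (∫ u, ‖K u‖) * M := by
  rw [← integral_mul_const]
  refine norm_integral_le_of_norm_le (hK.norm.mul_const M) (ae_of_all _ fun u => ?_)
  rw [norm_mul]
  exact mul_le_mul_of_nonneg_left (hM _) (norm_nonneg _)

theorem norm_smoothing_sub_le (hK : Integrable K) (hc : Continuous h) (hM : ∀ t, ‖h t‖ ≤ M)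
    {s t ε : ℝ} (hst : ∀ u, ‖h (s - u) - h (t - u)‖ ≤ ε) :
    ‖smoothing K h s - smoothing K h t‖ ≤ (∫ u, ‖K u‖) * ε := by
  rw [smoothing, smoothing, ← integral_sub (integrable_smoothing hK hc hM s)
    (integrable_smoothing hK hc hM t), ← integral_mul_const]
  refine norm_integral_le_of_norm_le (hK.norm.mul_const ε) (ae_of_all _ fun u => ?_)
  rw [← mul_sub, norm_mul]
  exact mul_le_mul_of_nonneg_left (hst _) (norm_nonneg _)

theorem isBohrAP_smoothing (hh : IsBohrAP h) (hK : Integrable K) : IsBohrAP (smoothing K h) := by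
  obtain ⟨M, hM0, hM⟩ := hh.exists_bound
  set N := ∫ u, ‖K u‖ with hN
  have hN0 : 0 ≤ N := integral_nonneg fun u => norm_nonneg _
  refine ⟨⟨N * M, fun s _ => norm_smoothing_le hK hM _⟩, ?_, fun ε hε => ?_⟩
  · refine Metric.uniformContinuousOn_iff.2 fun ε hε => ?_
    obtain ⟨δ, hδ, H⟩ := hh.exists_delta (show 0 < ε / (N + 1) by positivity)
    refine ⟨δ, hδ, fun s _ t _ hst => ?_⟩
    rw [dist_eq_norm] at hst ⊢
    have := norm_smoothing_sub_le hK hh.continuous hM (s := s.im) (t := t.im) (ε := ε / (N + 1))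
      fun u => (H _ _ (by
        rw [sub_sub_sub_cancel_right, ← Complex.sub_im]
        exact (Complex.abs_im_le_norm _).trans_lt hst)).le
    refine this.trans_lt ?_
    rw [← hN, mul_div_assoc', div_lt_iff₀ (by positivity)]
    nlinarith
  · refine (hh.relativelyDense (ε / (N + 1)) (by positivity)).mono fun τ hτ s _ => ?_
    have hτ' : ∀ t, ‖h (t + τ) - h t‖ ≤ ε / (N + 1) := fun t => by
      simpa using hτ _ (one_add_mem t)
    have him : (s + Complex.I * τ).im = s.im + τ := by simp
    simp only [him]
    have := norm_smoothing_sub_le hK hh.continuous hM (s := s.im + τ) (t := s.im) (ε := ε / (N + 1))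
      fun u => by
        rw [add_sub_right_comm]; exact hτ' _
    refine this.trans ?_
    rw [← hN, mul_div_assoc', div_le_iff₀ (by positivity)]
    nlinarith

theorem norm_sub_smoothing_le (hK : Integrable K) (hK1 : Integrable fun u => |u| * ‖K u‖)
    (hone : ∫ u, K u = 1) (hc : Continuous h) (hM : ∀ t, ‖h t‖ ≤ M) {L : ℝ}
    (hL : ∀ s t, ‖h t - h s‖ ≤ L * |t - s|) (t : ℝ) :
    ‖h t - smoothing K h t‖ ≤ L * ∫ u, |u| * ‖K u‖ := by
  have : h t = ∫ u, K u * h t := by rw [integral_mul_const, hone, one_mul]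
  rw [smoothing, this, ← integral_sub (hK.mul_const _) (integrable_smoothing hK hc hM t),
    ← integral_const_mul]
  refine norm_integral_le_of_norm_le (hK1.const_mul L) (ae_of_all _ fun u => ?_)
  rw [← mul_sub, norm_mul]
  have := hL (t - u) t
  rw [sub_sub_cancel] at this
  calc _ ≤ ‖K u‖ * (L * |u|) := mul_le_mul_of_nonneg_left this (norm_nonneg _)
    _ = _ := by ring

/-- By Fubini, each `u` contributes the integral over `[-T, T]` shifted by `-u`, times `character μ
u`. Undoing the shift changes two end pieces of length `|u|`, so the error does not grow with `T`.
-/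
theorem norm_integral_smoothing_sub_le (hK : Integrable K)
    (hK1 : Integrable fun u => |u| * ‖K u‖)
    (hc : Continuous h) (hM : ∀ t, ‖h t‖ ≤ M) (μ : ℝ) {T : ℝ} (hT : 0 ≤ T) :
    ‖(∫ t in (-T)..T, smoothing K h t * character μ t)
      - (∫ u, K u * character μ u) * ∫ t in (-T)..T, h t * character μ t‖
      ≤ 2 * M * ∫ u, |u| * ‖K u‖ := by
  have hM' := norm_mul_character_le hM μ
  have hi : ∀ a b, IntervalIntegrable (fun t => h t * character μ t) volume a b :=
    fun a b => (hc.mul (continuous_character μ)).intervalIntegrable a b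
  have e1 : ∫ t in (-T)..T, smoothing K h t * character μ t
      = ∫ u, K u * ∫ t in (-T)..T, h (t - u) * character μ t := by
    simp only [smoothing, ← integral_mul_const, intervalIntegral.integral_of_le (by linarith : -T ≤ T),
      ← integral_const_mul]
    rw [integral_integral_swap]
    · simp only [mul_assoc]
    · have h1 : Integrable (fun p : ℝ × ℝ => K p.2 * (h (p.1 - p.2) * character μ p.1))
          ((volume.restrict (Set.Ioc (-T) T)).prod volume) := by
        refine Integrable.mul_bdd (c := M) ?_ (Continuous.aestronglyMeasurable (by fun_prop))
          (ae_of_all _ fun p => ?_)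
        · exact hK.comp_snd _
        · rw [norm_mul, norm_character, mul_one]; exact hM _
      simpa only [Function.uncurry_def, mul_assoc] using h1
  have e2 : ∀ u, ∫ t in (-T)..T, h (t - u) * character μ t
      = character μ u * ∫ t in (-T - u)..(T - u), h t * character μ t := fun u => by
    rw [← intervalIntegral.integral_const_mul,
      ← intervalIntegral.integral_comp_sub_right (fun t => character μ u * (h t * character μ t))]
    refine intervalIntegral.integral_congr fun t _ => ?_
    have : character μ t = character μ u * character μ (t - u) := by
      rw [← character_add, add_sub_cancel]
    simp only [this]; ring
  have hB : ∀ a b u, ‖∫ t in (a - u)..(b - u), h t * character μ t‖ ≤ M * |b - a| := fun a b u => by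
    simpa using norm_intervalIntegral_le hM' (a - u) (b - u)
  have hcont : Continuous fun u => ∫ t in (-T - u)..(T - u), h t * character μ t := by
    have hF : Continuous fun x => ∫ t in (0 : ℝ)..x, h t * character μ t :=
      intervalIntegral.continuous_primitive hi 0
    have : (fun u => ∫ t in (-T - u)..(T - u), h t * character μ t)
        = fun u => (∫ t in (0 : ℝ)..(T - u), h t * character μ t)
          - ∫ t in (0 : ℝ)..(-T - u), h t * character μ t := funext fun u => by
      rw [intervalIntegral.integral_interval_sub_left (hi _ _) (hi _ _)]
    rw [this]
    exact (hF.comp (by fun_prop)).sub (hF.comp (by fun_prop))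
  have hint : Integrable fun u => K u * (character μ u *
      ∫ t in (-T - u)..(T - u), h t * character μ t) :=
    hK.mul_bdd (c := M * |T - -T|)
      (((continuous_character μ).mul hcont).aestronglyMeasurable)
      (ae_of_all _ fun u => by rw [norm_mul, norm_character, one_mul]; exact hB _ _ _)
  have hint2 : Integrable fun u => K u * character μ u * ∫ t in (-T)..T, h t * character μ t :=
    (hK.mul_bdd (c := 1) (continuous_character μ).aestronglyMeasurable
      (ae_of_all _ fun u => (norm_character _ _).le)).mul_const _
  rw [e1, ← integral_mul_const]
  simp only [e2]
  rw [← integral_sub hint hint2, ← integral_const_mul]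
  refine norm_integral_le_of_norm_le (hK1.const_mul _) (ae_of_all _ fun u => ?_)
  rw [← mul_assoc, ← mul_sub, norm_mul, norm_mul, norm_character, mul_one]
  have e3 : (∫ t in (-T - u)..(T - u), h t * character μ t) - ∫ t in (-T)..T, h t * character μ t
      = (∫ t in (-T - u)..(-T), h t * character μ t) + ∫ t in T..(T - u), h t * character μ t := by
    have := intervalIntegral.integral_add_adjacent_intervals (hi (-T - u) (-T)) (hi (-T) T)
    have := intervalIntegral.integral_add_adjacent_intervals (hi (-T - u) T) (hi T (T - u))
    linear_combination -this - ‹_ + _ = ∫ t in (-T - u)..T, h t * character μ t›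
  have e4 : ‖(∫ t in (-T - u)..(T - u), h t * character μ t) - ∫ t in (-T)..T, h t * character μ t‖
      ≤ 2 * M * |u| := by
    rw [e3]
    refine (norm_add_le _ _).trans ?_
    have h1 := norm_intervalIntegral_le hM' (-T - u) (-T)
    have h2 := norm_intervalIntegral_le hM' T (T - u)
    rw [sub_sub_cancel] at h1
    rw [sub_sub_cancel_left, abs_neg] at h2
    linarith
  calc _ ≤ ‖K u‖ * (2 * M * |u|) := mul_le_mul_of_nonneg_left e4 (norm_nonneg _)
    _ = _ := by ring

end Smoothing

/-! ### Means over symmetric intervals -/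

/-- The mean of `h` over `[-T, T]`. -/
noncomputable def lineMean (h : ℝ → ℂ) (T : ℝ) : ℂ := (1 / (2 * T) : ℂ) * ∫ t in (-T)..T, h t

theorem lineMean_sub {h g : ℝ → ℂ} (hh : Continuous h) (hg : Continuous g) (T : ℝ) :
    lineMean (fun t => h t - g t) T = lineMean h T - lineMean g T := by
  rw [lineMean, lineMean, lineMean, ← mul_sub, intervalIntegral.integral_sub
    (hh.intervalIntegrable _ _) (hg.intervalIntegrable _ _)]

theorem lineMean_const_mul (h : ℝ → ℂ) (c : ℂ) (T : ℝ) :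
    lineMean (fun t => c * h t) T = c * lineMean h T := by
  rw [lineMean, lineMean, intervalIntegral.integral_const_mul, mul_left_comm]

theorem lineMean_sum {ι : Type*} (S : Finset ι) {h : ι → ℝ → ℂ} (hh : ∀ i, Continuous (h i)) (T : ℝ) :
    lineMean (fun t => ∑ i ∈ S, h i t) T = ∑ i ∈ S, lineMean (h i) T := by
  simp only [lineMean]
  rw [intervalIntegral.integral_finsetSum fun i _ => (hh i).intervalIntegrable _ _, Finset.mul_sum]

theorem norm_one_div_two_mul {T : ℝ} (hT : 0 < T) : ‖(1 / (2 * T) : ℂ)‖ = 1 / (2 * T) := by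
  rw [norm_div, norm_mul, norm_one, Complex.norm_ofNat, Complex.norm_real, Real.norm_of_nonneg hT.le]

theorem norm_lineMean_le {h : ℝ → ℂ} {M : ℝ} (hM : ∀ t, ‖h t‖ ≤ M) {T : ℝ} (hT : 0 < T) :
    ‖lineMean h T‖ ≤ M := by
  have := norm_intervalIntegral_le hM (-T) T
  rw [show T - -T = 2 * T by ring, abs_of_pos (by linarith)] at this
  rw [lineMean, norm_mul, norm_one_div_two_mul hT, one_div, inv_mul_le_iff₀ (by linarith)]
  linarith

theorem tendsto_lineMean_character (ν : ℝ) :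
    Tendsto (lineMean (character ν)) atTop (𝓝 (if ν = 0 then 1 else 0)) := by
  split_ifs with hν
  · refine tendsto_const_nhds.congr' ((eventually_gt_atTop 0).mono fun T hT => ?_)
    have : (T : ℂ) ≠ 0 := by exact_mod_cast hT.ne'
    simp only [lineMean, hν, character, zero_mul, Complex.ofReal_zero, Complex.exp_zero,
      intervalIntegral.integral_const, sub_neg_eq_add, Complex.real_smul, Complex.ofReal_add]
    field_simp
    norm_num
  · have hν' : (Complex.I * ν : ℂ) ≠ 0 := mul_ne_zero Complex.I_ne_zero (by exact_mod_cast hν)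
    have hint : ∀ T, ∫ t in (-T)..T, character ν t
        = (character ν T - character ν (-T)) / (Complex.I * ν) := fun T => by
      have := integral_exp_mul_complex (a := -T) (b := T) hν'
      have hch : ∀ t : ℝ, character ν t = Complex.exp (Complex.I * ν * t) := fun t => by
        rw [character]; congr 1; push_cast; ring
      simp only [hch]
      exact this
    refine squeeze_zero_norm' (a := fun T : ℝ => |ν|⁻¹ * T⁻¹) ((eventually_gt_atTop 0).mono fun T hT => ?_)
      (by simpa using (tendsto_inv_atTop_zero (𝕜 := ℝ)).const_mul |ν|⁻¹)
    rw [lineMean, hint, norm_mul, norm_one_div_two_mul hT, norm_div, norm_mul, Complex.norm_I,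
      one_mul, Complex.norm_real, Real.norm_eq_abs]
    have := norm_sub_le (character ν T) (character ν (-T))
    rw [norm_character, norm_character] at this
    have hν0 : 0 < |ν| := abs_pos.2 hν
    calc 1 / (2 * T) * (‖character ν T - character ν (-T)‖ / |ν|) ≤ 1 / (2 * T) * ((1 + 1) / |ν|) := by
          gcongr
      _ = _ := by field_simp; norm_num

theorem bohrMean_eq (f : BoundedFun) (μ σ T : ℝ) :
    bohrMean f μ σ T = Complex.exp (μ * σ) *
      lineMean (fun t => ext f (σ + Complex.I * t) * character μ t) T := by
  rw [← lineMean_const_mul, bohrMean, lineMean]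
  congr 1
  refine intervalIntegral.integral_congr fun t _ => ?_
  have : Complex.exp (μ * (σ + Complex.I * t)) = Complex.exp (μ * σ) * character μ t := by
    rw [character, ← Complex.exp_add]; congr 1; push_cast; ring
  simp only [this]; ring

/-- Stated for a filter finer than `atTop` so that it applies to limits of means along an
ultrafilter. -/
theorem meanSmall_of_tendsto {h : ℝ → ℂ} {l : Filter ℝ} [l.NeBot] (hl : l ≤ atTop)
    (hh : Tendsto (lineMean h) l (𝓝 0)) : MeanSmall h := by
  intro η hη S₀
  obtain ⟨T, hT, hT0, hT1⟩ := ((Metric.tendsto_nhds.1 hh (η / 2) (half_pos hη)).and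
    (((eventually_gt_atTop 0).filter_mono hl).and
      ((eventually_ge_atTop S₀).filter_mono hl))).exists
  refine ⟨T, hT1, ?_⟩
  rw [dist_zero_right, lineMean, norm_mul, norm_one_div_two_mul hT0, one_div,
    inv_mul_lt_iff₀ (by linarith)] at hT
  linarith

theorem IsBohrAP.add {h g : ℝ → ℂ} (hh : IsBohrAP h) (hg : IsBohrAP g) :
    IsBohrAP fun t => h t + g t := AlmostPeriodicOn.add hh hg

theorem IsBohrAP.const_mul {h : ℝ → ℂ} (hh : IsBohrAP h) (c : ℂ) : IsBohrAP fun t => c * h t :=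
  AlmostPeriodicOn.const_mul hh c

theorem AlmostPeriodicOn.sum {ι : Type*} {κ : ℝ} (S : Finset ι) {f : ι → ℂ → ℂ}
    (hf : ∀ i ∈ S, AlmostPeriodicOn κ (f i)) : AlmostPeriodicOn κ fun s => ∑ i ∈ S, f i s := by
  classical
  induction S using Finset.induction_on with
  | empty => simpa using! AlmostPeriodicOn.zero κ
  | insert a S ha ih =>
    simp only [Finset.sum_insert ha]
    exact (hf a (Finset.mem_insert_self a S)).add
      (ih fun i hi => hf i (Finset.mem_insert_of_mem hi))

theorem AlmostPeriodicOn.isBohrAP {κ σ : ℝ} {f : ℂ → ℂ} (hf : AlmostPeriodicOn κ f) (hσ : κ < σ) :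
    IsBohrAP fun t => f (σ + Complex.I * t) := by
  have hmem : ∀ t : ℝ, (σ + Complex.I * t : ℂ) ∈ halfPlane κ := fun t => by
    simpa [halfPlane] using hσ
  refine ⟨?_, ?_, fun ε hε => ?_⟩
  · obtain ⟨M, hM⟩ := hf.bounded
    exact ⟨M, fun s _ => hM _ (hmem _)⟩
  · refine Metric.uniformContinuousOn_iff.2 fun ε hε => ?_
    obtain ⟨δ, hδ, H⟩ := Metric.uniformContinuousOn_iff.1 hf.uniformContinuousOn ε hε
    refine ⟨δ, hδ, fun s _ t _ hst => H _ (hmem _) _ (hmem _) ?_⟩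
    rw [dist_eq_norm] at hst ⊢
    rw [add_sub_add_left_eq_sub, ← mul_sub, norm_mul, Complex.norm_I, one_mul,
      ← Complex.ofReal_sub, Complex.norm_real, ← Complex.sub_im]
    exact (Complex.abs_im_le_norm _).trans_lt hst
  · refine (hf.relativelyDense ε hε).mono fun τ hτ s _ => ?_
    have := hτ _ (hmem s.im)
    have him : ((s + Complex.I * τ).im : ℂ) = s.im + τ := by simp
    simp only [him]
    rwa [mul_add, ← add_assoc]

/-! ### Approximation by generalized Dirichlet polynomials -/

theorem tendsto_lineMean_smoothing {K h : ℝ → ℂ} {M : ℝ} (hK : Integrable K)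
    (hK1 : Integrable fun u => |u| * ‖K u‖) (hc : Continuous h) (hM : ∀ t, ‖h t‖ ≤ M) {ν : ℝ}
    (hν : (∫ u, K u * character ν u = 0) ∨
      Tendsto (lineMean fun t => h t * character ν t) atTop (𝓝 0)) :
    Tendsto (lineMean fun t => smoothing K h t * character ν t) atTop (𝓝 0) := by
  have h1 : Tendsto (fun T => lineMean (fun t => smoothing K h t * character ν t) T
      - (∫ u, K u * character ν u) * lineMean (fun t => h t * character ν t) T) atTop (𝓝 0) := by
    refine squeeze_zero_norm' (a := fun T => (M * ∫ u, |u| * ‖K u‖) * T⁻¹)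
      ((eventually_gt_atTop 0).mono fun T hT => ?_)
      (by simpa using (tendsto_inv_atTop_zero (𝕜 := ℝ)).const_mul (M * ∫ u, |u| * ‖K u‖))
    rw [lineMean, lineMean, mul_left_comm, ← mul_sub, norm_mul, norm_one_div_two_mul hT]
    calc _ ≤ 1 / (2 * T) * (2 * M * ∫ u, |u| * ‖K u‖) := by
          gcongr
          exact norm_integral_smoothing_sub_le hK hK1 hc hM ν hT.le
      _ = _ := by field_simp
  have h2 : Tendsto (fun T => (∫ u, K u * character ν u) *
      lineMean (fun t => h t * character ν t) T) atTop (𝓝 0) := by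
    rcases hν with hν | hν
    · simp [hν]
    · simpa using hν.const_mul (∫ u, K u * character ν u)
  simpa using h1.add h2

/-- If the Bohr spectrum of `h` meets the band of `K` in a finite set, then the convolution of `h`
with `K` is a trigonometric polynomial. -/
theorem IsBohrAP.smoothing_eq_sum {K h : ℝ → ℂ} {M : ℝ} (hh : IsBohrAP h) (hK : Integrable K)
    (hK1 : Integrable fun u => |u| * ‖K u‖) (hM : ∀ t, ‖h t‖ ≤ M) (Λ : Finset ℝ)
    (hΛ : ∀ ν ∉ Λ, (∫ u, K u * character ν u = 0) ∨
      Tendsto (lineMean fun t => h t * character ν t) atTop (𝓝 0)) :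
    ∃ a : ℝ → ℂ, (∀ μ, ‖a μ‖ ≤ (∫ u, ‖K u‖) * M) ∧
      ∀ t, smoothing K h t = ∑ μ ∈ Λ, a μ * character (-μ) t := by
  have hF := isBohrAP_smoothing hh hK
  set F := smoothing K h with hFdef
  have hFb : ∀ t, ‖F t‖ ≤ (∫ u, ‖K u‖) * M := norm_smoothing_le hK hM
  -- Bounded means always converge along an ultrafilter, so coefficients exist without a mean value
  -- theorem; `IsBohrAP.eq_zero` needs smallness only along arbitrarily large lengths.
  let l : Ultrafilter ℝ := Ultrafilter.of atTop
  have hl : (l : Filter ℝ) ≤ atTop := Ultrafilter.of_le _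
  have hex : ∀ μ, ∃ a : ℂ, ‖a‖ ≤ (∫ u, ‖K u‖) * M ∧
      Tendsto (lineMean fun t => F t * character μ t) l (𝓝 a) := fun μ => by
    obtain ⟨a, ha, hlim⟩ := (isCompact_closedBall (0 : ℂ) ((∫ u, ‖K u‖) * M)).ultrafilter_le_nhds'
      (l.map (lineMean fun t => F t * character μ t)) (by
        refine hl ((eventually_gt_atTop 0).mono fun T hT => ?_)
        refine mem_closedBall_zero_iff.2 ?_
        exact norm_lineMean_le (norm_mul_character_le hFb μ) hT)
    exact ⟨a, mem_closedBall_zero_iff.1 ha, hlim⟩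
  choose a ha hlim using hex
  refine ⟨a, ha, fun t₀ => ?_⟩
  have hzero : ∀ ν ∉ Λ, a ν = 0 := fun ν hν =>
    tendsto_nhds_unique (hlim ν)
      ((tendsto_lineMean_smoothing hK hK1 hh.continuous hM (hΛ ν hν)).mono_left hl)
  set P : ℝ → ℂ := fun t => ∑ μ ∈ Λ, a μ * character (-μ) t with hP
  have hPap : IsBohrAP P :=
    AlmostPeriodicOn.sum Λ fun μ _ => (isBohrAP_character (-μ)).const_mul (a μ)
  -- By orthogonality of characters, all means of `F - P` along `l` vanish.
  have hG : IsBohrAP fun t => F t + -1 * P t := hF.add (hPap.const_mul (-1))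
  have key := hG.eq_zero (fun ν => meanSmall_of_tendsto hl ?_) t₀
  · linear_combination key
  · have e : (lineMean fun t => (F t + -1 * P t) * character ν t)
        = fun T => lineMean (fun t => F t * character ν t) T
          - ∑ μ ∈ Λ, a μ * lineMean (character (ν - μ)) T := by
      funext T
      simp only [← lineMean_const_mul]
      rw [← lineMean_sum Λ (fun μ => by fun_prop) T,
        ← lineMean_sub (by have := hF.continuous; fun_prop) (by fun_prop)]
      congr 1
      funext t
      have : P t * character ν t = ∑ μ ∈ Λ, a μ * character (ν - μ) t := by
        rw [hP, Finset.sum_mul]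
        refine Finset.sum_congr rfl fun μ _ => ?_
        rw [mul_assoc, ← character_add_left, neg_add_eq_sub]
      rw [← this]; ring
    rw [e]
    have h2 : Tendsto (fun T => ∑ μ ∈ Λ, a μ * lineMean (character (ν - μ)) T) l
        (𝓝 (∑ μ ∈ Λ, a μ * if ν - μ = 0 then 1 else 0)) :=
      tendsto_finsetSum _ fun μ _ => ((tendsto_lineMean_character _).mono_left hl).const_mul _
    have h3 : ∑ μ ∈ Λ, (a μ * if ν - μ = 0 then 1 else 0) = a ν := by
      simp only [sub_eq_zero, mul_ite, mul_one, mul_zero, Finset.sum_ite_eq]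
      split_ifs with h
      · rfl
      · exact (hzero ν h).symm
    rw [h3] at h2
    simpa using (hlim ν).sub h2

/-- Phragmén–Lindelöf for the translate `z ↦ g (κ + z)`. As `g` is bounded, the growth condition
holds with exponent and constant `0`. -/
theorem norm_le_on_halfPlane {g : ℂ → ℂ} {κ C A : ℝ} (hκ : 0 < κ)
    (hd : DifferentiableOn ℂ g (halfPlane 0)) (hA : ∀ s ∈ halfPlane 0, ‖g s‖ ≤ A)
    (hline : ∀ t : ℝ, ‖g (κ + Complex.I * t)‖ ≤ C) {s : ℂ} (hs : s ∈ halfPlane κ) : ‖g s‖ ≤ C := by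
  have hmem : ∀ z : ℂ, 0 ≤ z.re → κ + z ∈ halfPlane 0 := fun z hz => by
    show 0 < (κ + z : ℂ).re
    rw [Complex.add_re, Complex.ofReal_re]; linarith
  have hcl : closure {z : ℂ | 0 < z.re} ⊆ {z : ℂ | 0 ≤ z.re} :=
    closure_minimal (fun z (hz : 0 < z.re) => hz.le) (isClosed_le continuous_const Complex.continuous_re)
  have := PhragmenLindelof.right_half_plane_of_bounded_on_real (f := fun z => g (κ + z)) (C := C)
    (z := s - κ) ?_ ⟨0, two_pos, 0, ?_⟩ ?_ (fun x => ?_) ?_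
  · simpa using this
  · refine DifferentiableOn.diffContOnCl ?_
    exact hd.comp (by fun_prop) fun z hz => hmem z (hcl hz)
  · refine Asymptotics.IsBigO.of_bound A ?_
    refine eventually_inf_principal.2 (Eventually.of_forall fun z hz => ?_)
    simpa using hA _ (hmem z (le_of_lt hz))
  · exact isBoundedUnder_of_eventually_le (a := A) ((eventually_ge_atTop 0).mono fun x hx =>
      hA _ (hmem _ (by simpa using hx)))
  · rw [mul_comm]; exact hline x
  · have : κ < s.re := hs
    simpa using this.le

theorem differentiableOn_exp_sum (Λ : Finset ℝ) (c : ℝ → ℂ) (S : Set ℂ) :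
    DifferentiableOn ℂ (fun s => ∑ μ ∈ Λ, c μ * Complex.exp (-(μ : ℂ) * s)) S := by
  fun_prop

/-- The kernel depends only on `κ` and `ε`, so the frequency set and the coefficient bounds serve
the whole unit ball. The polynomial is the analytic extension of the smoothed boundary function on
`Re s = κ`. -/
theorem exists_approx {lam : ℕ → ℝ} (hlam : IsFrequency lam) {κ ε : ℝ} (hκ : 0 < κ) (hε : 0 < ε) :
    ∃ (Λ : Finset ℝ) (B : ℝ → ℝ), (Λ : Set ℝ) ⊆ Set.range lam ∧
      ∀ f ∈ Hlam lam, ‖f‖ ≤ 1 → ∃ c : ℝ → ℂ, (∀ μ, ‖c μ‖ ≤ B μ) ∧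
        ∀ s ∈ halfPlane κ, ‖ext f s - ∑ μ ∈ Λ, c μ * Complex.exp (-(μ : ℂ) * s)‖ ≤ ε := by
  -- On `Re s = κ` the function has Lipschitz constant at most `1 / (κ / 2)`, so this first moment
  -- gives error `ε`.
  obtain ⟨K, X, hK, hK1, hone, hη, hX⟩ := exists_kernel (show 0 < ε * (κ / 2) by positivity)
  obtain ⟨N, hN⟩ := eventually_atTop.1 (hlam.tendsto.eventually_ge_atTop X)
  refine ⟨(Finset.range N).image lam, fun μ => (∫ u, ‖K u‖) * Real.exp (μ * κ), ?_,
    fun f hf hf1 => ?_⟩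
  · intro μ hμ
    obtain ⟨n, -, rfl⟩ := Finset.mem_image.1 (Finset.mem_coe.1 hμ)
    exact ⟨n, rfl⟩
  have hfi : f ∈ Hinf := hf.1.1
  have hκ2 : κ / 2 < κ := by linarith
  set h : ℝ → ℂ := fun t => ext f (κ + Complex.I * t) with hh
  have hap : IsBohrAP h := (Hap.almostPeriodicOn hf.1 (half_pos hκ)).isBohrAP hκ2
  have hM : ∀ t, ‖h t‖ ≤ 1 := fun t => (norm_ext_le f _).trans hf1
  have hmem : ∀ t : ℝ, (κ + Complex.I * t : ℂ) ∈ halfPlane (κ / 2) := fun t => by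
    simpa [halfPlane] using hκ2
  have hL : ∀ s t, ‖h t - h s‖ ≤ 1 / (κ / 2) * |t - s| := fun s t => by
    refine (Hinf.lipschitz hfi (half_pos hκ) (hmem s) (hmem t)).trans ?_
    rw [add_sub_add_left_eq_sub, ← mul_sub, norm_mul, Complex.norm_I, one_mul,
      ← Complex.ofReal_sub, Complex.norm_real, Real.norm_eq_abs]
    gcongr
  have hcoef : ∀ ν ∉ (Finset.range N).image lam, (∫ u, K u * character ν u = 0) ∨
      Tendsto (lineMean fun t => h t * character ν t) atTop (𝓝 0) := fun ν hν => by
    rcases le_or_gt X |ν| with hνX | hνX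
    · exact Or.inl (hX ν hνX)
    · refine Or.inr ?_
      have hB : HasBohrCoeff f ν 0 := by
        rcases lt_or_ge ν 0 with hν0 | hν0
        · exact HasBohrCoeff.zero_of_neg hfi hν0
        · by_contra hcon
          obtain ⟨n, rfl⟩ := hf.2 ⟨hν0, hcon⟩
          refine hν (Finset.mem_image.2 ⟨n, Finset.mem_range.2 ?_, rfl⟩)
          by_contra hnN
          have := hN n (not_lt.1 hnN)
          linarith [le_abs_self (lam n)]
      have h1 := (hB κ hκ).const_mul (Complex.exp (ν * κ))⁻¹
      rw [mul_zero] at h1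
      refine h1.congr fun T => ?_
      rw [bohrMean_eq, inv_mul_cancel_left₀ (Complex.exp_ne_zero _)]
  obtain ⟨a, ha, hsum⟩ := hap.smoothing_eq_sum hK hK1 hM _ hcoef
  -- The factor `e^{μκ}` compensates `e^{-μκ}`, the modulus of `e^{-μs}` on the line `Re s = κ`.
  refine ⟨fun μ => a μ * Complex.exp (μ * κ), fun μ => ?_, fun s hs => ?_⟩
  · rw [norm_mul, Complex.norm_exp, ← Complex.ofReal_mul, Complex.ofReal_re]
    refine mul_le_mul_of_nonneg_right ((ha μ).trans_eq (mul_one _)) (Real.exp_pos _).le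
  · have hre : ∀ μ ∈ (Finset.range N).image lam, 0 ≤ μ := fun μ hμ => by
      obtain ⟨n, -, rfl⟩ := Finset.mem_image.1 hμ
      exact hlam.nonneg n
    refine norm_le_on_halfPlane (A := 1 + ∑ μ ∈ (Finset.range N).image lam,
        ‖a μ * Complex.exp (μ * κ)‖) hκ
      ((differentiableOn_ext hfi).sub (differentiableOn_exp_sum _ _ _)) (fun z hz => ?_) (fun t => ?_)
      hs
    · refine (norm_sub_le _ _).trans (add_le_add ((norm_ext_le f z).trans hf1) ?_)
      refine (norm_sum_le _ _).trans (Finset.sum_le_sum fun μ hμ => ?_)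
      rw [norm_mul]
      exact mul_le_of_le_one_right (norm_nonneg _) (norm_exp_neg_mul_le (hre μ hμ) (le_of_lt hz))
    · have e : ∑ μ ∈ (Finset.range N).image lam, a μ * Complex.exp (μ * κ) *
          Complex.exp (-(μ : ℂ) * (κ + Complex.I * t)) = smoothing K h t := by
        rw [hsum t]
        refine Finset.sum_congr rfl fun μ _ => ?_
        rw [mul_assoc, ← Complex.exp_add, character]
        congr 2
        push_cast; ring
      refine (congrArg (fun w => ‖h t - w‖) e).trans_le ?_
      refine (norm_sub_smoothing_le hK hK1 hone hap.continuous hM hL t).trans ?_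
      rw [one_div, inv_mul_le_iff₀ (half_pos hκ), mul_comm]
      exact hη

/-! ### Exponentials and limits of Dirichlet polynomials -/

/-- The function `s ↦ e^{-μs}` on the right half-plane. -/
noncomputable def expFun (μ : ℝ) (hμ : 0 ≤ μ) : BoundedFun :=
  BoundedContinuousFunction.ofNormedAddCommGroup
    (fun s : RightHalfPlane => Complex.exp (-(μ : ℂ) * s)) (by fun_prop) 1
    fun s => norm_exp_neg_mul_le hμ (le_of_lt s.2)

theorem expFun_apply (μ : ℝ) (hμ : 0 ≤ μ) (s : RightHalfPlane) :
    expFun μ hμ s = Complex.exp (-(μ : ℂ) * s) := rfl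

theorem norm_expFun_le (μ : ℝ) (hμ : 0 ≤ μ) : ‖expFun μ hμ‖ ≤ 1 :=
  BoundedContinuousFunction.norm_ofNormedAddCommGroup_le _ zero_le_one _

theorem ext_expFun {μ : ℝ} (hμ : 0 ≤ μ) {s : ℂ} (hs : s ∈ halfPlane 0) :
    ext (expFun μ hμ) s = Complex.exp (-(μ : ℂ) * s) := ext_of_mem _ hs

theorem expFun_mem_Hinf {μ : ℝ} (hμ : 0 ≤ μ) : expFun μ hμ ∈ Hinf :=
  DifferentiableOn.congr (f := fun s : ℂ => Complex.exp (-(μ : ℂ) * s)) (by fun_prop)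
    fun _ hs => ext_expFun hμ hs

/-- Almost periodicity and vanishing means both survive uniform limits. The means are computed on
the line `Re s = κ + 1`, inside the region of approximation, and then moved to any `σ > 0`. -/
theorem mem_Hlam_of_approx {lam : ℕ → ℝ} (hlam : ∀ n, 0 ≤ lam n) {f : BoundedFun} (hf : f ∈ Hinf)
    {κ : ℝ} (hκ : 0 < κ) (happ : ∀ ε > 0, ∃ (N : ℕ) (c : ℕ → ℂ), ∀ s ∈ halfPlane κ,
      ‖ext f s - ∑ n ∈ Finset.range N, c n * Complex.exp (-(lam n : ℂ) * s)‖ ≤ ε) :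
    f ∈ Hlam lam := by
  refine ⟨⟨hf, κ, hκ, AlmostPeriodicOn.of_approx fun ε hε => ?_⟩, fun μ hμ => ?_⟩
  · obtain ⟨N, c, hc⟩ := happ ε hε
    exact ⟨_, AlmostPeriodicOn.sum _ fun n _ =>
      (almostPeriodicOn_exp (hlam n) hκ.le).const_mul (c n), hc⟩
  · by_contra hrange
    refine hμ.2 fun σ hσ => ?_
    have hσ' : 0 < κ + 1 := by linarith
    suffices H : Tendsto (bohrMean f μ (κ + 1)) atTop (𝓝 0) by
      simpa using (tendsto_bohrMean_sub hf (μ := μ) hσ' hσ).add H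
    have hline : ∀ t : ℝ, (((κ + 1 : ℝ) : ℂ) + Complex.I * t) ∈ halfPlane κ := fun t => by
      simp [halfPlane]
    have hcont : Continuous fun t : ℝ => ext f (((κ + 1 : ℝ) : ℂ) + Complex.I * t) := by
      have := continuous_bohrIntegrand f 0 hσ'
      simpa using this
    suffices H : Tendsto (lineMean fun t => ext f (((κ + 1 : ℝ) : ℂ) + Complex.I * t) *
        character μ t) atTop (𝓝 0) by
      have := H.const_mul (Complex.exp (μ * (κ + 1 : ℝ)))
      rw [mul_zero] at this
      exact this.congr fun T => (bohrMean_eq f μ (κ + 1) T).symm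
    refine Metric.tendsto_nhds.2 fun ε hε => ?_
    obtain ⟨N, c, hc⟩ := happ (ε / 2) (half_pos hε)
    set b : ℕ → ℂ := fun n => c n * Complex.exp (-(lam n : ℂ) * (κ + 1 : ℝ)) with hb
    have hexp : ∀ t : ℝ, (∑ n ∈ Finset.range N, c n *
        Complex.exp (-(lam n : ℂ) * (((κ + 1 : ℝ) : ℂ) + Complex.I * t))) * character μ t
        = ∑ n ∈ Finset.range N, b n * character (μ - lam n) t := fun t => by
      rw [Finset.sum_mul]
      refine Finset.sum_congr rfl fun n _ => ?_
      rw [hb, mul_assoc, mul_assoc, sub_eq_neg_add, character_add_left]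
      simp only [character, mul_add, Complex.exp_add]
      push_cast
      ring_nf
    have hP : Tendsto (fun T => ∑ n ∈ Finset.range N, b n * lineMean (character (μ - lam n)) T)
        atTop (𝓝 0) := by
      have : Tendsto (fun T => ∑ n ∈ Finset.range N, b n * lineMean (character (μ - lam n)) T)
          atTop (𝓝 (∑ n ∈ Finset.range N, b n * 0)) := by
        refine tendsto_finsetSum _ fun n _ => Tendsto.const_mul _ ?_
        have := tendsto_lineMean_character (μ - lam n)
        rwa [if_neg (sub_ne_zero.2 fun h => hrange ⟨n, h.symm⟩)] at this
      simpa using this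
    filter_upwards [Metric.tendsto_nhds.1 hP (ε / 2) (half_pos hε), eventually_gt_atTop 0]
      with T hT hT0
    rw [dist_zero_right] at hT ⊢
    have hsum : ∑ n ∈ Finset.range N, b n * lineMean (character (μ - lam n)) T
        = lineMean (fun t => ∑ n ∈ Finset.range N, b n * character (μ - lam n) t) T := by
      rw [lineMean_sum _ (fun n => by fun_prop)]
      simp only [lineMean_const_mul]
    have hsub := lineMean_sub (h := fun t => ext f (((κ + 1 : ℝ) : ℂ) + Complex.I * t) *
      character μ t) (hcont.mul (continuous_character μ))
      (show Continuous fun t => ∑ n ∈ Finset.range N, b n * character (μ - lam n) t by fun_prop) T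
    have hle : ‖lineMean (fun t => ext f (((κ + 1 : ℝ) : ℂ) + Complex.I * t) * character μ t
        - ∑ n ∈ Finset.range N, b n * character (μ - lam n) t) T‖ ≤ ε / 2 := by
      refine norm_lineMean_le (fun t => ?_) hT0
      rw [← hexp t, ← sub_mul, norm_mul, norm_character, mul_one]
      exact hc _ (hline t)
    rw [hsub, ← hsum] at hle
    have := norm_add_le (lineMean (fun t => ext f (((κ + 1 : ℝ) : ℂ) + Complex.I * t) *
      character μ t) T - ∑ n ∈ Finset.range N, b n * lineMean (character (μ - lam n)) T)
      (∑ n ∈ Finset.range N, b n * lineMean (character (μ - lam n)) T)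
    rw [sub_add_cancel] at this
    exact (this.trans (add_le_add hle le_rfl)).trans_lt (by linarith)

theorem expFun_sum (lam : ℕ → ℝ) (n N : ℕ) (hN : n < N) (s : ℂ) :
    ∑ k ∈ Finset.range N, (Pi.single n 1 : ℕ → ℂ) k * Complex.exp (-(lam k : ℂ) * s)
      = Complex.exp (-(lam n : ℂ) * s) := by
  rw [Finset.sum_eq_single_of_mem n (Finset.mem_range.2 hN) fun k _ hk => by simp [hk]]
  simp

theorem expFun_mem_Hlam {lam : ℕ → ℝ} (hlam : IsFrequency lam) (n : ℕ) :
    expFun (lam n) (hlam.nonneg n) ∈ Hlam lam := by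
  refine mem_Hlam_of_approx hlam.nonneg (expFun_mem_Hinf _) one_pos fun ε hε =>
    ⟨n + 1, Pi.single n 1, fun s hs => ?_⟩
  rw [expFun_sum lam n _ n.lt_succ_self, ext_expFun _ (halfPlane_anti zero_le_one hs), sub_self,
    norm_zero]
  exact hε.le

theorem expFun_mem_Dext {lam : ℕ → ℝ} (hlam : IsFrequency lam) (n : ℕ) :
    expFun (lam n) (hlam.nonneg n) ∈ Dext lam := by
  refine ⟨expFun_mem_Hinf _, Pi.single n 1, 1, one_pos, fun s hs => ?_⟩
  rw [ext_expFun _ (halfPlane_anti zero_le_one hs)]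
  refine tendsto_const_nhds.congr' ((eventually_gt_atTop n).mono fun N hN => ?_)
  exact (expFun_sum lam n N hN s).symm

/-- A finite abscissa supplies a real point of convergence, where the terms are positive and
convergence is summability. -/
theorem exists_summable_exp {lam : ℕ → ℝ} (hL : abscissaL lam < ⊤) :
    ∃ σ : ℝ, Summable fun n => Real.exp (-lam n * σ) := by
  obtain ⟨_, ⟨σ, ⟨z, hz⟩, rfl⟩, -⟩ := sInf_lt_iff.1 hL
  refine ⟨σ, ?_⟩
  have h1 := (Complex.continuous_re.tendsto z).comp hz
  have h2 : (fun N => ∑ n ∈ Finset.range N, Real.exp (-lam n * σ))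
      = Complex.re ∘ fun N : ℕ => ∑ n ∈ Finset.range N,
        (1 : ℂ) * Complex.exp (-(lam n : ℂ) * (σ : ℂ)) := by
    funext N
    simp only [Function.comp, Complex.re_sum, one_mul]
    refine Finset.sum_congr rfl fun n _ => ?_
    rw [← Complex.ofReal_neg, ← Complex.ofReal_mul, Complex.exp_ofReal_re]
  exact ((hasSum_iff_tendsto_nat_of_nonneg (fun n => (Real.exp_pos _).le) _).2
    (by rw [h2]; exact h1)).summable

/-- Convergence at `κ + 1` bounds the terms there; moving right by a further `|σ|` gains the
summable factor `e^{-λ_n σ}`, and the Weierstrass test makes the partial sums converge uniformly. -/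
theorem Dext_le_Hlam {lam : ℕ → ℝ} (hlam : IsFrequency lam) (hL : abscissaL lam < ⊤) :
    Dext lam ≤ Hlam lam := by
  rintro f ⟨hf, a, κ, hκ, ha⟩
  obtain ⟨σ, hσ⟩ := exists_summable_exp hL
  set κ₁ := κ + 1 + |σ| with hκ₁
  have hκκ₁ : κ ≤ κ₁ := by have := abs_nonneg σ; linarith
  have h1 : ((κ + 1 : ℝ) : ℂ) ∈ halfPlane κ := by simp [halfPlane]
  obtain ⟨B, hB⟩ : ∃ B, ∀ n, ‖a n * Complex.exp (-(lam n : ℂ) * (κ + 1 : ℝ))‖ ≤ B := by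
    have h2 := ha _ h1
    have h3 := (h2.comp (tendsto_add_atTop_nat 1)).sub h2
    obtain ⟨B, hB⟩ := h3.norm.bddAbove_range
    refine ⟨B, fun n => ?_⟩
    have := hB ⟨n, rfl⟩
    simpa [Finset.sum_range_succ] using this
  have hterm : ∀ n, ∀ s ∈ halfPlane κ₁, ‖a n * Complex.exp (-(lam n : ℂ) * s)‖
      ≤ B * Real.exp (-lam n * σ) := fun n s hs => by
    have hs' : κ₁ < s.re := hs
    have e : Complex.exp (-(lam n : ℂ) * s) = Complex.exp (-(lam n : ℂ) * (κ + 1 : ℝ)) *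
        Complex.exp (-(lam n : ℂ) * (s - (κ + 1 : ℝ))) := by
      rw [← Complex.exp_add]; congr 1; ring
    rw [e, ← mul_assoc, norm_mul]
    refine mul_le_mul (hB n) ?_ (norm_nonneg _) ((norm_nonneg _).trans (hB n))
    rw [Complex.norm_exp, ← Complex.ofReal_neg, Complex.re_ofReal_mul, Complex.sub_re,
      Complex.ofReal_re]
    refine Real.exp_le_exp.2 (mul_le_mul_of_nonpos_left ?_ (neg_nonpos.2 (hlam.nonneg n)))
    linarith [le_abs_self σ]
  have hunif := tendstoUniformlyOn_tsum_nat (hσ.mul_left B) hterm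
  refine mem_Hlam_of_approx hlam.nonneg hf (hκ.trans_le hκκ₁) fun ε hε => ?_
  obtain ⟨N, hN⟩ := (Metric.tendstoUniformlyOn_iff.1 hunif ε hε).exists
  refine ⟨N, a, fun s hs => ?_⟩
  have hsum : ∑' n, a n * Complex.exp (-(lam n : ℂ) * s) = ext f s :=
    tendsto_nhds_unique (Summable.of_norm_bounded (hσ.mul_left B)
      fun n => hterm n s hs).hasSum.tendsto_sum_nat (ha s (halfPlane_anti hκκ₁ hs))
  have := hN s hs
  rw [dist_eq_norm, hsum] at this
  exact this.le

/-! ### Compactness of composition operators -/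

/-- Values of `φ` lie where `exists_approx` applies, so the image of the unit ball is within `ε / 2`
of the image of a finite-dimensional polydisc, which is compact. -/
theorem isCompactOperator_of_range {lam : ℕ → ℝ} (hlam : IsFrequency lam)
    {W : Submodule ℂ BoundedFun} (hW : W ≤ Hlam lam)
    (hexp : ∀ n, expFun (lam n) (hlam.nonneg n) ∈ W) {φ : RightHalfPlane → RightHalfPlane}
    {C : W →L[ℂ] Hap} (hC : IsCompositionOperator W φ C) {κ : ℝ} (hκ : 0 < κ)
    (hφ : ∀ s, (φ s : ℂ) ∈ halfPlane κ) : IsCompactOperator C := by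
  have := completeSpace_Hap
  have htb : TotallyBounded (C '' Metric.closedBall 0 1) := by
    refine Metric.totallyBounded_iff.2 fun ε hε => ?_
    obtain ⟨Λ, B, hΛ, happ⟩ := exists_approx hlam hκ (show 0 < ε / 2 by positivity)
    -- Since `lam` may repeat values, one index is selected for each frequency.
    choose idx hidx using fun μ : Λ => hΛ μ.2
    let e : Λ → W := fun μ => ⟨expFun (lam (idx μ)) (hlam.nonneg _), hexp _⟩
    let L : (Λ → ℂ) → Hap := fun c => C (∑ μ, c μ • e μ)
    have hL : Continuous L := C.continuous.comp (by fun_prop)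
    have hS : IsCompact (L '' Set.univ.pi fun μ : Λ => Metric.closedBall (0 : ℂ) (B μ)) :=
      (isCompact_univ_pi fun μ => isCompact_closedBall _ _).image hL
    obtain ⟨t, ht, hcov⟩ := Metric.totallyBounded_iff.1 hS.totallyBounded (ε / 2) (by positivity)
    refine ⟨t, ht, ?_⟩
    rintro _ ⟨f, hf, rfl⟩
    obtain ⟨c, hcB, hc⟩ := happ f (hW f.2) (mem_closedBall_zero_iff.1 hf)
    obtain ⟨y, hy, hLy⟩ := Set.mem_iUnion₂.1 (hcov ⟨fun μ : Λ => c μ, fun μ _ =>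
      mem_closedBall_zero_iff.2 (hcB μ), rfl⟩)
    refine Set.mem_iUnion₂.2 ⟨y, hy, ?_⟩
    have hdist : dist (C f) (L fun μ => c μ) ≤ ε / 2 := by
      rw [dist_eq_norm, ← map_sub]
      refine (BoundedContinuousFunction.norm_le (by positivity)).2 fun s => ?_
      have h1 := hc _ (hφ s)
      rw [ext_apply, ← Finset.sum_coe_sort] at h1
      have h2 : ((∑ μ : Λ, c μ • e μ : W) : BoundedFun) (φ s)
          = ∑ μ : Λ, c μ * Complex.exp (-((μ : ℝ) : ℂ) * (φ s : ℂ)) := by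
        simp [e, expFun_apply, hidx]
      refine (congrArg norm (hC _ s)).trans_le ?_
      rw [Submodule.coe_sub, BoundedContinuousFunction.sub_apply, h2]
      exact h1
    rw [Metric.mem_ball] at hLy ⊢
    linarith [dist_triangle (C f) (L fun μ => c μ) y]
  refine (isCompactOperator_iff_isCompact_closure_image_closedBall (C : W →ₗ[ℂ] Hap) one_pos).2 ?_
  exact htb.closure.isCompact_of_isClosed isClosed_closure

theorem exists_range_of_isCompactOperator {lam : ℕ → ℝ} (hlam : IsFrequency lam)
    {W : Submodule ℂ BoundedFun}
    (hexp : ∀ n, expFun (lam n) (hlam.nonneg n) ∈ W) {φ : RightHalfPlane → RightHalfPlane}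
    {C : W →L[ℂ] Hap} (hC : IsCompositionOperator W φ C) (hcomp : IsCompactOperator C) :
    ∃ κ : ℝ, 0 < κ ∧ ∀ s : RightHalfPlane, (φ s : ℂ) ∈ halfPlane κ := by
  by_contra! hcon
  let e : ℕ → W := fun n => ⟨expFun (lam n) (hlam.nonneg n), hexp n⟩
  obtain ⟨S, hS, hsub⟩ := hcomp.image_closedBall_subset_compact (f := (C : W →ₗ[ℂ] Hap)) 1
  have hmem : ∀ n, C (e n) ∈ S := fun n =>
    hsub ⟨e n, mem_closedBall_zero_iff.2 (norm_expFun_le _ (hlam.nonneg n)), rfl⟩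
  obtain ⟨g, -, ψ, hψ, hlim⟩ := hS.tendsto_subseq hmem
  have happ : ∀ n (s : RightHalfPlane), ((C (e n) : BoundedFun)) s
      = Complex.exp (-(lam n : ℂ) * (φ s : ℂ)) := fun n s => by
    rw [hC]; rfl
  have hnorm : ∀ n (s : RightHalfPlane), ‖((C (e n) : BoundedFun)) s‖
      = Real.exp (-lam n * (φ s : ℂ).re) := fun n s => by
    rw [happ, Complex.norm_exp, ← Complex.ofReal_neg, Complex.re_ofReal_mul]
  have hlim' : Tendsto (fun k => (C (e (ψ k)) : BoundedFun)) atTop (𝓝 (g : BoundedFun)) :=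
    (continuous_subtype_val.tendsto g).comp hlim
  have hg : (g : BoundedFun) = 0 := by
    ext s
    have h1 : Tendsto (fun k => (C (e (ψ k)) : BoundedFun) s) atTop (𝓝 ((g : BoundedFun) s)) :=
      ((continuous_eval_const s).tendsto _).comp hlim'
    refine tendsto_nhds_unique h1 (tendsto_zero_iff_norm_tendsto_zero.2 ?_)
    simp only [hnorm]
    refine Real.tendsto_exp_atBot.comp ?_
    have hpos : 0 < (φ s : ℂ).re := (φ s).2
    simp only [neg_mul]
    exact tendsto_neg_atTop_atBot.comp
      ((hlam.tendsto.comp hψ.tendsto_atTop).atTop_mul_const hpos)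
  rw [hg] at hlim'
  obtain ⟨k, hk⟩ := (Metric.tendsto_nhds.1 hlim' (1 / 2) (by norm_num)).exists
  rw [dist_zero_right] at hk
  have hle : ∀ s : RightHalfPlane, Real.exp (-lam (ψ k) * (φ s : ℂ).re) < 1 / 2 := fun s => by
    rw [← hnorm]
    exact (BoundedContinuousFunction.norm_coe_le_norm _ s).trans_lt hk
  have hln : 0 ≤ lam (ψ k) := hlam.nonneg _
  -- At such a point `λ * Re φ ≤ 1 / 2`, so `e^{-λ Re φ} ≥ 1 - 1 / 2`, against the strict bound
  -- `hle`. Adding `1` covers the case `λ = 0`.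
  obtain ⟨s, hs⟩ := hcon (1 / (2 * (lam (ψ k) + 1))) (by positivity)
  have hs' : (φ s : ℂ).re ≤ 1 / (2 * (lam (ψ k) + 1)) := not_lt.1 hs
  have h1 : lam (ψ k) * (φ s : ℂ).re ≤ 1 / 2 := by
    calc _ ≤ (lam (ψ k) + 1) * (1 / (2 * (lam (ψ k) + 1))) :=
          mul_le_mul (by linarith) hs' (le_of_lt (φ s).2) (by linarith)
      _ = 1 / 2 := by field_simp
  have h2 := Real.add_one_le_exp (-lam (ψ k) * (φ s : ℂ).re)
  linarith [hle s]

end HalfPlane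

theorem mainTheorem8 (lam : ℕ → ℝ) (hlam : HalfPlane.IsFrequency lam)
    (W : Submodule ℂ HalfPlane.BoundedFun)
    (hW : (W = HalfPlane.Dext lam ∧ HalfPlane.abscissaL lam < ⊤) ∨ W = HalfPlane.Hlam lam)
    (φ : HalfPlane.RightHalfPlane → HalfPlane.RightHalfPlane)
    (C : W →L[ℂ] HalfPlane.Hap) (hC : HalfPlane.IsCompositionOperator W φ C) :
    IsCompactOperator C ↔
      ∃ κ : ℝ, 0 < κ ∧ ∀ s : HalfPlane.RightHalfPlane, (φ s : ℂ) ∈ HalfPlane.halfPlane κ := by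
  have hle : W ≤ HalfPlane.Hlam lam := by
    rcases hW with ⟨rfl, hL⟩ | rfl
    · exact HalfPlane.Dext_le_Hlam hlam hL
    · exact le_rfl
  have hexp : ∀ n, HalfPlane.expFun (lam n) (hlam.nonneg n) ∈ W := fun n => by
    rcases hW with ⟨rfl, -⟩ | rfl
    · exact HalfPlane.expFun_mem_Dext hlam n
    · exact HalfPlane.expFun_mem_Hlam hlam n
  refine ⟨HalfPlane.exists_range_of_isCompactOperator hlam hexp hC, ?_⟩
  rintro ⟨κ, hκ, hφ⟩
  exact HalfPlane.isCompactOperator_of_range hlam hle hexp hC hκ hφ
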